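/- **Setting.** Let $1\le K\le n$ and $m\ge 1$. For $i\le n$ let $f_i=\sum_{j=1}^m f_{ij}$, where $f_{ij}:\mathbb R^d\to\mathbb R$ is convex, differentiable and $L_{ij}$-smooth ($L_{ij}\ge 0$). Let $\sigma>0$ and let $\theta_\star$ minimize $\sum_{i=1}^n\big[f_i(\theta)+\frac\sigma2\|\theta\|^2\big]$. Put $\tilde\sigma=\frac{n\sigma}{n+K}$. Let $W\in\mathbb R^{n\times n}$ be column-stochastic, $W_{ij}$ being the probability that a token jumps from node $j$ to node $i$. **Algorithms.** Parameters: $p_{\rm comm}+p_{\rm comp}=1$, $\alpha$, $\eta$, and a distribution $(q_{ij})_{j\le m}$ for each $i$. Nodes hold $\theta^{(i)}$ and $z^{(ij)}$, tokens hold $\tau^{(k)}$, $k\le K$; initially $z^{(ij)}_0$ and the token positions are arbitrary, $\theta_0^{(i)}=-\frac1{\tilde\sigma}\sum_j\nabla f_{ij}(z_0^{(ij)})$, $\tau^{(k)}_0=0$. At each iteration: - with probability $p_{\rm comm}$, a uniformly random token $k$ makes $N$ successive jumps according to $W$ from its current position, lands at a node $i$, and, with $\rho_{\rm comm}=\frac{nK\eta}{p_{\rm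 comm}\tilde\sigma}$, $(\tau^{(k)},\theta^{(i)})$ becomes $\big(\tau^{(k)}-\rho_{\rm comm}(\tau^{(k)}-\theta^{(i)}),\ \theta^{(i)}+\rho_{\rm comm}(\tau^{(k)}-\theta^{(i)})\big)$; - otherwise a uniformly random node $i$ draws $j$ with probability $q_{ij}$ and, with $\rho_{ij}=\frac{n\alpha\eta}{p_{\rm comp}q_{ij}}$, computes $z'=(1-\rho_{ij})z^{(ij)}+\rho_{ij}\theta^{(i)}$, replaces $\theta^{(i)}$ by $\theta^{(i)}-\frac1{\tilde\sigma}(\nabla f_{ij}(z')-\nabla f_{ij}(z^{(ij)}))$ and then $z^{(ij)}$ by $z'$. *Token Gradient Descent* (Algorithm 1): $m=1$, $q_{i1}=1$, $L_{i1}=L$ for all $i$, $p_{\rm comm}=p_{\rm comp}=\frac12$, $\eta=\min\big(\frac{\tilde\sigma p_{\rm comm}}{2nK},\frac{p_{\rm comp}}{n\alpha(1+L/\tilde\sigma)}\big)$, and either $\alpha=\frac{2K}{L}$, in which case $L\ge\sigma$ is assumed, or $\alpha=\frac{2K}{\tilde\sigma+L}$. Put $\mu=\frac{K}{\tilde\sigma+L}$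 and $\kappa=1+\frac L\sigma$. *Token Variance Reduction* (TVR): $\kappa_s=\max_i\big(1+\sum_jL_{ij}/\tilde\sigma\big)$, $p_{\rm comp}=\big(1+\frac{\kappa_s}{m-1+\kappa_s}\big)^{-1}$, $q_{ij}\propto 1+L_{ij}/\tilde\sigma$ in $j$, $\alpha=\frac{2K}{\tilde\sigma\kappa_s}$, $\eta=\min\big(\frac{\tilde\sigma p_{\rm comm}}{2nK},\frac{p_{\rm comp}}{\alpha n(m-1+\kappa_s)}\big)$. Put $\mu=\frac{K}{\tilde\sigma\kappa_s}$. **Notation.** $\log_+x=\max(1,\log x)$. Let $e_t=\sum_i\|\theta_t^{(i)}-\theta_\star\|^2+\sum_k\|\tau_t^{(k)}-\theta_\star\|^2$ and $E_0=e_0+\sum_{i,j}\|z_0^{(ij)}-\theta_\star\|^2$. **Theorem.** There is an absolute constant $a>0$ such that for every $A\ge a$ there is a constant $c>0$, depending only on $A$, with the following property. Suppose that for some $C>0$, $\gamma>0$, $$\|W^t\pi_0-\pi_\star\|_\infty\le C(1-\gamma)^t\quad\text{for all probability vectors }\pi_0\text{ and all }t\ge0,$$ where $\pi_\star=(1/n,\dots,1/n)$,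 and that $\frac a\gamma\log_+\frac{C}{\eta\mu}\le N\le\frac A\gamma\log_+\frac{C}{\eta\mu}$. Let $\varepsilon>0$. 1. For Token Gradient Descent there is $T$ such that $\mathbb E[e_t]\le\varepsilon$ for all $t\ge T$, while the expected total number of token jumps in the first $T$ iterations is at most $$c\,\frac{n\kappa}{\gamma}\,\log_+\!\Big(\frac{C}{\eta\mu}\Big)\log_+\!\Big(\frac{\kappa^2E_0}{\varepsilon}\Big),$$ and the expected number of jumps of each single token is at most $1/K$ times this bound. 2. For TVR there is $T$ such that $\mathbb E[e_t]\le\varepsilon$ for all $t\ge T$, while the expected total number of token jumps in the first $T$ iterations is at most $$c\,\frac{n\kappa_s}{\gamma}\,\log_+\!\Big(\frac{C}{\eta\mu}\Big)\log_+\!\Big(\frac{\kappa_s^2E_0}{\varepsilon}\Big),$$ the expected number of jumps of each single token is at most $1/K$ times this bound, and each node makes in expectation at most $c\,(m+\kappa_s)\log_+(\kappa_s^2E_0/\varepsilon)$ stochastic gradient steps. -/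

import Mathlib

open scoped ENNReal Gradient

noncomputable section

namespace TokenAlg

/-! ### Objective functions -/

/-- The parameter space `ℝ^d` with its Euclidean norm. -/
abbrev Vec (d : ℕ) : Type := EuclideanSpace ℝ (Fin d)

/-- `f` is convex, differentiable and `L`-smooth (its gradient is `L`-Lipschitz) on `ℝ^d`. -/
structure ConvexSmooth {d : ℕ} (f : Vec d → ℝ) (L : ℝ) : Prop where
  convex : ConvexOn ℝ Set.univ f
  differentiable : Differentiable ℝ f
  smooth : ∀ x y : Vec d, ‖∇ f x - ∇ f y‖ ≤ L * ‖x - y‖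

/-- The global objective `∑ i, (f_i(θ) + σ/2 ‖θ‖²)`, where `f_i = ∑ j, f_{ij}`. -/
def objective {n m d : ℕ} (f : Fin n → Fin m → Vec d → ℝ) (σ : ℝ) (θ : Vec d) : ℝ :=
  ∑ i, ((∑ j, f i j θ) + σ / 2 * ‖θ‖ ^ 2)

/-! ### Finite probability distributions -/

/-- The probability distribution with the given real weights on a finite type. -/
def ofWeights {ι : Type} [Fintype ι] (w : ι → ℝ) (hw : w ∈ stdSimplex ℝ ι) : PMF ι :=
  PMF.ofFintype (fun i => ENNReal.ofReal (w i)) (by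
    rw [← ENNReal.ofReal_sum_of_nonneg (fun i _ => hw.1 i), hw.2, ENNReal.ofReal_one])

/-- A coin that shows `true` with probability `p`. -/
def coin (p : ℝ) (hp : p ∈ Set.Icc (0 : ℝ) 1) : PMF Bool :=
  ofWeights (fun b => if b then p else 1 - p) (by
    refine ⟨fun b => ?_, by simp⟩
    cases b
    · simpa using hp.2
    · simpa using hp.1)

/-- Expected value of a nonnegative function. -/
def expect {α : Type} (p : PMF α) (φ : α → ℝ≥0∞) : ℝ≥0∞ := ∑' a, p a * φ a

/-! ### The random walk of a token

`W` is column-stochastic, `W i j` being the probability of a jump from node `j` to node `i`, so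
that `W ^ t *ᵥ π₀` is the law of the position after `t` jumps from a position of law `π₀`. -/

/-- One jump from node `j`. -/
def jump {n : ℕ} (W : Matrix (Fin n) (Fin n) ℝ) (hW : W ∈ Matrix.colStochastic ℝ (Fin n))
    (j : Fin n) : PMF (Fin n) :=
  ofWeights (fun i => W i j)
    ⟨fun i => (Matrix.mem_colStochastic_iff_sum.1 hW).1 i j,
      (Matrix.mem_colStochastic_iff_sum.1 hW).2 j⟩

/-- The position after `N` successive jumps from node `j`. -/
def walk {n : ℕ} (W : Matrix (Fin n) (Fin n) ℝ) (hW : W ∈ Matrix.colStochastic ℝ (Fin n)) :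
    ℕ → Fin n → PMF (Fin n)
  | 0, j => PMF.pure j
  | N + 1, j => (jump W hW j).bind (walk W hW N)

/-- `‖W^t π₀ - π⋆‖_∞ ≤ C (1 - γ)^t` for every initial distribution `π₀` and every `t`
(the norm of `Fin n → ℝ` is the sup norm). -/
def MixesTo {n : ℕ} (W : Matrix (Fin n) (Fin n) ℝ) (πstar : Fin n → ℝ) (C γ : ℝ) : Prop :=
  ∀ π₀ ∈ stdSimplex ℝ (Fin n), ∀ t : ℕ,
    ‖Matrix.mulVec (W ^ t) π₀ - πstar‖ ≤ C * (1 - γ) ^ t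

/-! ### Token algorithms -/

/-- State of a token algorithm with `n` nodes, `m` data points per node and `K` tokens.
The last two fields only count the jumps made by each token and the gradient steps made by
each node. -/
structure State (n m K d : ℕ) where
  /-- local parameters of the nodes -/
  node : Fin n → Vec d
  /-- parameters of the tokens -/
  token : Fin K → Vec d
  /-- parameters of the virtual nodes -/
  z : Fin n → Fin m → Vec d
  /-- current positions of the tokens -/
  pos : Fin K → Fin n
  /-- number of jumps made by each token -/
  jumps : Fin K → ℕ
  /-- number of gradient steps made by each node -/
  grads : Fin n → ℕ

/-- Parameters of a token algorithm. -/
structure Params (n m : ℕ) where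
  /-- the regularization of each node and token in the conceptual graph -/
  σt : ℝ
  /-- probability of a communication step -/
  pcomm : ℝ
  pcomm_mem : pcomm ∈ Set.Icc (0 : ℝ) 1
  /-- step-size of communication steps -/
  ρcomm : ℝ
  /-- law of the data point used in a computation step at a given node -/
  q : Fin n → Fin m → ℝ
  q_mem : ∀ i, q i ∈ stdSimplex ℝ (Fin m)
  /-- step-size of computation steps -/
  ρcomp : Fin n → Fin m → ℝ

section
variable {n m K d : ℕ}

/-- Initialization: `θ^(i) = -∑ j, ∇f_{ij}(z₀^(ij)) / σt`, and all tokens are zero. -/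
def initState (f : Fin n → Fin m → Vec d → ℝ) (P : Params n m)
    (z₀ : Fin n → Fin m → Vec d) (pos₀ : Fin K → Fin n) : State n m K d where
  node i := -((1 / P.σt) • ∑ j, ∇ (f i j) (z₀ i j))
  token _ := 0
  z := z₀
  pos := pos₀
  jumps _ := 0
  grads _ := 0

/-- Token `k`, having made `N` jumps and landed at node `i`, averages with node `i`. -/
def commUpdate (P : Params n m) (N : ℕ) (s : State n m K d) (k : Fin K) (i : Fin n) :
    State n m K d where
  node := Function.update s.node i (s.node i + P.ρcomm • (s.token k - s.node i))
  token := Function.update s.token k (s.token k - P.ρcomm • (s.token k - s.node i))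
  z := s.z
  pos := Function.update s.pos k i
  jumps := Function.update s.jumps k (s.jumps k + N)
  grads := s.grads

/-- The new value of `z^(ij)` in a computation step. -/
def newZ (P : Params n m) (s : State n m K d) (i : Fin n) (j : Fin m) : Vec d :=
  (1 - P.ρcomp i j) • s.z i j + P.ρcomp i j • s.node i

/-- Node `i` makes a gradient step with its data point `j`. -/
def compUpdate (f : Fin n → Fin m → Vec d → ℝ) (P : Params n m) (s : State n m K d)
    (i : Fin n) (j : Fin m) : State n m K d where
  node := Function.update s.node i
    (s.node i - (1 / P.σt) • (∇ (f i j) (newZ P s i j) - ∇ (f i j) (s.z i j)))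
  token := s.token
  z := Function.update s.z i (Function.update (s.z i) j (newZ P s i j))
  pos := s.pos
  jumps := s.jumps
  grads := Function.update s.grads i (s.grads i + 1)

/-- One iteration. With probability `pcomm`, a uniformly random token makes `N` jumps and averages
with the node it lands at; otherwise a uniformly random node makes a gradient step. -/
def step [NeZero n] [NeZero K] (f : Fin n → Fin m → Vec d → ℝ) (P : Params n m)
    (W : Matrix (Fin n) (Fin n) ℝ) (hW : W ∈ Matrix.colStochastic ℝ (Fin n)) (N : ℕ)
    (s : State n m K d) : PMF (State n m K d) :=
  (coin P.pcomm P.pcomm_mem).bind fun communicate =>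
    if communicate then
      (PMF.uniformOfFintype (Fin K)).bind fun k =>
        (walk W hW N (s.pos k)).map fun i => commUpdate P N s k i
    else
      (PMF.uniformOfFintype (Fin n)).bind fun i =>
        (ofWeights (P.q i) (P.q_mem i)).map fun j => compUpdate f P s i j

/-- Law of the state after `t` iterations from the state `s₀`. -/
def law [NeZero n] [NeZero K] (f : Fin n → Fin m → Vec d → ℝ) (P : Params n m)
    (W : Matrix (Fin n) (Fin n) ℝ) (hW : W ∈ Matrix.colStochastic ℝ (Fin n)) (N : ℕ)
    (s₀ : State n m K d) : ℕ → PMF (State n m K d)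
  | 0 => PMF.pure s₀
  | t + 1 => (law f P W hW N s₀ t).bind (step f P W hW N)

/-- Squared distance to `θ⋆` of the parameters of all nodes and tokens. -/
def sqError (θstar : Vec d) (s : State n m K d) : ℝ :=
  (∑ i, ‖s.node i - θstar‖ ^ 2) + ∑ k, ‖s.token k - θstar‖ ^ 2

/-- Squared distance to `θ⋆` of all parameters of the state, including those of virtual nodes. -/
def fullSqError (θstar : Vec d) (s : State n m K d) : ℝ :=
  sqError θstar s + ∑ i, ∑ j, ‖s.z i j - θstar‖ ^ 2

end

/-! ### Parameters of the two algorithms -/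

/-- `σ̃ = n σ / (n + K)`. -/
def sigmaT (n K : ℕ) (σ : ℝ) : ℝ := (n : ℝ) / ((n : ℝ) + K) * σ

/-- `η` for Token Gradient Descent with `p_comm = p_comp = 1/2`. -/
def etaTGD (n K : ℕ) (σ L α : ℝ) : ℝ :=
  min (sigmaT n K σ * (1 / 2) / (2 * n * K)) ((1 / 2) / (n * α * (1 + L / sigmaT n K σ)))

/-- Relative strong convexity constant `μ = K / (σ̃ + L)` of the dual problem. -/
def muTGD (n K : ℕ) (σ L : ℝ) : ℝ := K / (sigmaT n K σ + L)

/-- Token Gradient Descent with `p_comm = p_comp = 1/2`. -/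
def paramsTGD (n K : ℕ) (σ L α : ℝ) : Params n 1 where
  σt := sigmaT n K σ
  pcomm := 1 / 2
  pcomm_mem := by constructor <;> norm_num
  ρcomm := n * K * etaTGD n K σ L α / ((1 / 2) * sigmaT n K σ)
  q _ _ := 1
  q_mem _ := ⟨fun _ => zero_le_one, by simp⟩
  ρcomp _ _ := n * α * etaTGD n K σ L α / (1 / 2)

/-- `κ_s = max_i (1 + ∑ j, L_{ij} / σ̃)`. -/
def kappaS {n m : ℕ} [NeZero n] (K : ℕ) (σ : ℝ) (L : Fin n → Fin m → ℝ) : ℝ :=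
  Finset.univ.sup' Finset.univ_nonempty fun i => 1 + ∑ j, L i j / sigmaT n K σ

/-- `p_comp = (1 + κ_s / (m - 1 + κ_s))⁻¹`. -/
def pcompTVR {n m : ℕ} [NeZero n] (K : ℕ) (σ : ℝ) (L : Fin n → Fin m → ℝ) : ℝ :=
  (1 + kappaS K σ L / ((m : ℝ) - 1 + kappaS K σ L))⁻¹

/-- `α = 2 K / (σ̃ κ_s)`. -/
def alphaTVR {n m : ℕ} [NeZero n] (K : ℕ) (σ : ℝ) (L : Fin n → Fin m → ℝ) : ℝ :=
  2 * K / (sigmaT n K σ * kappaS K σ L)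

/-- `η` for TVR. -/
def etaTVR {n m : ℕ} [NeZero n] (K : ℕ) (σ : ℝ) (L : Fin n → Fin m → ℝ) : ℝ :=
  min (sigmaT n K σ * (1 - pcompTVR K σ L) / (2 * n * K))
    (pcompTVR K σ L / (alphaTVR K σ L * n * ((m : ℝ) - 1 + kappaS K σ L)))

/-- Relative strong convexity constant `μ = K / (σ̃ κ_s)` of the dual problem. -/
def muTVR {n m : ℕ} [NeZero n] (K : ℕ) (σ : ℝ) (L : Fin n → Fin m → ℝ) : ℝ :=
  K / (sigmaT n K σ * kappaS K σ L)

/-- Probability of the data point `j` at node `i`, proportional to `1 + L_{ij} / σ̃`.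
It is uniform when the `L_{ij}` are all equal. -/
def samplingTVR {n m : ℕ} (K : ℕ) (σ : ℝ) (L : Fin n → Fin m → ℝ) (i : Fin n) (j : Fin m) : ℝ :=
  (1 + L i j / sigmaT n K σ) / ∑ j', (1 + L i j' / sigmaT n K σ)

theorem sigmaT_nonneg (n K : ℕ) {σ : ℝ} (hσ : 0 < σ) : 0 ≤ sigmaT n K σ := by
  unfold sigmaT; positivity

theorem one_le_kappaS {n m : ℕ} [NeZero n] (K : ℕ) {σ : ℝ} (hσ : 0 < σ)
    {L : Fin n → Fin m → ℝ} (hL : ∀ i j, 0 ≤ L i j) : 1 ≤ kappaS K σ L := by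
  unfold kappaS
  refine le_trans ?_ (Finset.le_sup' (fun i => 1 + ∑ j, L i j / sigmaT n K σ)
    (Finset.mem_univ (0 : Fin n)))
  have : 0 ≤ ∑ j, L 0 j / sigmaT n K σ :=
    Finset.sum_nonneg fun j _ => div_nonneg (hL 0 j) (sigmaT_nonneg n K hσ)
  simpa using this

theorem pcompTVR_mem {n m : ℕ} [NeZero n] [NeZero m] (K : ℕ) {σ : ℝ} (hσ : 0 < σ)
    {L : Fin n → Fin m → ℝ} (hL : ∀ i j, 0 ≤ L i j) :
    pcompTVR K σ L ∈ Set.Icc (0 : ℝ) 1 := by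
  have h1 := one_le_kappaS K hσ hL
  have hm : (1 : ℝ) ≤ m := by exact_mod_cast Nat.one_le_iff_ne_zero.2 (NeZero.ne m)
  have h2 : 0 ≤ kappaS K σ L / ((m : ℝ) - 1 + kappaS K σ L) :=
    div_nonneg (by linarith) (by linarith)
  unfold pcompTVR
  exact ⟨inv_nonneg.2 (by linarith), inv_le_one_of_one_le₀ (by linarith)⟩

theorem samplingTVR_mem {n m : ℕ} [NeZero m] (K : ℕ) {σ : ℝ} (hσ : 0 < σ)
    {L : Fin n → Fin m → ℝ} (hL : ∀ i j, 0 ≤ L i j) (i : Fin n) :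
    samplingTVR K σ L i ∈ stdSimplex ℝ (Fin m) := by
  have h : ∀ j, 0 < 1 + L i j / sigmaT n K σ := fun j => by
    have := div_nonneg (hL i j) (sigmaT_nonneg n K hσ)
    linarith
  have hs : 0 < ∑ j, (1 + L i j / sigmaT n K σ) :=
    Finset.sum_pos (fun j _ => h j) Finset.univ_nonempty
  refine ⟨fun j => (div_pos (h j) hs).le, ?_⟩
  unfold samplingTVR
  rw [← Finset.sum_div, div_self hs.ne']

/-- Token Variance Reduction. The coordinate `(i, j)` is sampled with probability
`p_{ij} = p_comp / n * samplingTVR i j`, and its step-size is `α η / p_{ij}`. -/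
def paramsTVR {n m : ℕ} [NeZero n] [NeZero m] (K : ℕ) (σ : ℝ) (hσ : 0 < σ)
    (L : Fin n → Fin m → ℝ) (hL : ∀ i j, 0 ≤ L i j) : Params n m where
  σt := sigmaT n K σ
  pcomm := 1 - pcompTVR K σ L
  pcomm_mem := ⟨by linarith [(pcompTVR_mem K hσ hL).2], by linarith [(pcompTVR_mem K hσ hL).1]⟩
  ρcomm := n * K * etaTVR K σ L / ((1 - pcompTVR K σ L) * sigmaT n K σ)
  q := samplingTVR K σ L
  q_mem := samplingTVR_mem K hσ hL
  ρcomp i j := alphaTVR K σ L * etaTVR K σ L / (pcompTVR K σ L / n * samplingTVR K σ L i j)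

/-- `max 1 (log x)`: the logarithm as it appears in complexity bounds. -/
def logP (x : ℝ) : ℝ := max 1 (Real.log x)

end TokenAlg

end

/-! Split the regularization into quadratics of parameter $\tilde\sigma$, one per node and one per
token; nothing is lost, as $(n+K)\tilde\sigma=n\sigma$. Join nodes and tokens by a complete
bipartite graph and node $i$ to virtual nodes carrying the $f_{ij}$. Both algorithms are randomized
coordinate descent on the dual problem: a meeting of token $k$ with node $i$ updates the variable of
that edge, and a gradient step updates the variable of $(i,j)$ in the Bregman geometry of the
conjugate of $f_{ij}$, so that only gradients at $z^{(ij)}$ are needed. The state sees the edge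
variables only through their marginals, so `flowSq` measures them by the flow of least norm.

`lyapunov` adds the dual suboptimality to $\mu$ times the divergence from the dual optimum. If
tokens landed at uniform nodes, it would contract by $1-\frac23\eta\mu$
(`Admissible.uniform_step_le`). The step-size conditions absorb all second-order terms
(`Admissible.lyapunov_commUpdate_le`, `Admissible.lyapunov_compUpdate_le`). The first-order terms
add up exactly by `Balanced.sum_inner_eq`, and relative strong convexity
(`Admissible.μ_mul_flowSq_le`) bounds their sum below by $\frac23$ of the Lyapunov function.

After $N$ jumps the landing law is within $C(1-\gamma)^N$ of uniform from every starting node, while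
a communication step multiplies the Lyapunov function by at most 8. For $N$ as in `MixesTo.error_le`
the bias costs at most $\frac16\eta\mu$, so the contraction $1-\frac12\eta\mu$ holds conditionally
on every balanced state, and token positions need not be tracked. Hence order
$\log_+(\cdot)/(\eta\mu)$ iterations suffice. Each costs $p_{\rm comm}N$ jumps on average, and
$p_{\rm comm}/(\eta\mu)$ is of order $n\kappa$, respectively $n\kappa_s$. -/

noncomputable section

namespace TokenAlg

/-! ### Bregman divergences of convex smooth functions -/

/-- The Bregman divergence `f x - f y - ⟪∇f y, x - y⟫`. -/
def bregman {d : ℕ} (f : Vec d → ℝ) (x y : Vec d) : ℝ :=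
  f x - f y - inner ℝ (∇ f y) (x - y)

theorem hasDerivAt_comp_segment {d : ℕ} {f : Vec d → ℝ} (hf : Differentiable ℝ f)
    (y v : Vec d) (t : ℝ) :
    HasDerivAt (fun t : ℝ => f (y + t • v)) (inner ℝ (∇ f (y + t • v)) v) t := by
  have h1 : HasDerivAt (fun t : ℝ => y + t • v) v t := by
    simpa using ((hasDerivAt_id t).smul_const v).const_add y
  have h2 := (hf (y + t • v)).hasFDerivAt.comp_hasDerivAt t h1
  rw [inner_gradient_left]
  exact h2

theorem ConvexSmooth.bregman_nonneg {d : ℕ} {f : Vec d → ℝ} {L : ℝ} (h : ConvexSmooth f L)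
    (x y : Vec d) : 0 ≤ bregman f x y := by
  have hc : ConvexOn ℝ Set.univ (fun t : ℝ => f (y + t • (x - y))) := by
    have h0 := h.convex.comp_affineMap (AffineMap.lineMap y x : ℝ →ᵃ[ℝ] Vec d)
    rw [Set.preimage_univ] at h0
    have h1 : (fun t : ℝ => f (y + t • (x - y)))
        = f ∘ (AffineMap.lineMap y x : ℝ →ᵃ[ℝ] Vec d) := by
      ext t
      simp [AffineMap.lineMap_apply, add_comm]
    rwa [h1]
  have h1 := hc.le_slope_of_hasDerivAt (Set.mem_univ 0) (Set.mem_univ 1) one_pos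
    (hasDerivAt_comp_segment h.differentiable y (x - y) 0)
  simp only [slope_def_field, zero_smul, add_zero, one_smul, add_sub_cancel, sub_zero,
    div_one] at h1
  unfold bregman
  linarith

theorem ConvexSmooth.bregman_le {d : ℕ} {f : Vec d → ℝ} {L : ℝ} (h : ConvexSmooth f L)
    (x y : Vec d) : bregman f x y ≤ L / 2 * ‖x - y‖ ^ 2 := by
  set v := x - y with hv
  have hd : ∀ t : ℝ, HasDerivAt
      (fun t : ℝ => f (y + t • v) - t * inner ℝ (∇ f y) v - L / 2 * t ^ 2 * ‖v‖ ^ 2)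
      (inner ℝ (∇ f (y + t • v)) v - inner ℝ (∇ f y) v - L * t * ‖v‖ ^ 2) t := by
    intro t
    have h1 := hasDerivAt_comp_segment h.differentiable y v t
    have h2 := (hasDerivAt_id t).mul_const (inner ℝ (∇ f y) v)
    have h3 := (((hasDerivAt_id t).pow 2).const_mul (L / 2)).mul_const (‖v‖ ^ 2)
    exact ((h1.sub h2).sub h3).congr_deriv (by
      simp only [id, Nat.cast_ofNat, Nat.add_one_sub_one, pow_one]
      ring)
  -- By Cauchy–Schwarz and the Lipschitz gradient, subtracting the linear and quadratic terms makes
  -- the derivative along the segment nonpositive.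
  have hanti := antitoneOn_of_deriv_nonpos (convex_Icc (0 : ℝ) 1)
    (fun t _ => (hd t).continuousAt.continuousWithinAt)
    (fun t _ => (hd t).differentiableAt.differentiableWithinAt) (by
      intro t ht
      rw [interior_Icc] at ht
      rw [(hd t).deriv, ← inner_sub_left]
      have h1 := real_inner_le_norm (∇ f (y + t • v) - ∇ f y) v
      have h2 := h.smooth (y + t • v) y
      rw [add_sub_cancel_left, norm_smul, Real.norm_of_nonneg ht.1.le] at h2
      have h3 := mul_le_mul_of_nonneg_right h2 (norm_nonneg v)
      nlinarith)
  have h01 := hanti (Set.left_mem_Icc.2 zero_le_one) (Set.right_mem_Icc.2 zero_le_one)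
    zero_le_one
  simp only [one_smul, zero_smul, add_zero] at h01
  have hx : y + v = x := by simp [hv]
  rw [hx] at h01
  unfold bregman
  linarith

theorem bregman_three_point {d : ℕ} (f : Vec d → ℝ) (u x y : Vec d) :
    bregman f u y = bregman f u x + bregman f x y + inner ℝ (∇ f x - ∇ f y) (u - x) := by
  have h : u - y = (u - x) + (x - y) := by abel
  unfold bregman
  rw [h, inner_add_right, inner_sub_left]
  ring

theorem bregman_add_bregman {d : ℕ} (f : Vec d → ℝ) (x y : Vec d) :
    bregman f x y + bregman f y x = inner ℝ (∇ f x - ∇ f y) (x - y) := by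
  have h : y - x = -(x - y) := by abel
  unfold bregman
  rw [h, inner_neg_right, inner_sub_left]
  ring

/-- A gradient step of length $1/L$ from `x` for the function `bregman f · y` decreases it by at
least $\|g\|^2/(2L)$, where $g=\nabla f(x)-\nabla f(y)$, and the result is still nonnegative. -/
theorem ConvexSmooth.sq_norm_gradient_sub_le {d : ℕ} {f : Vec d → ℝ} {L : ℝ}
    (h : ConvexSmooth f L) (hL : 0 ≤ L) (x y : Vec d) :
    ‖∇ f x - ∇ f y‖ ^ 2 ≤ 2 * L * bregman f x y := by
  rcases hL.eq_or_lt with rfl | hL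
  · have := h.smooth x y
    rw [zero_mul] at this
    simp [le_antisymm this (norm_nonneg _)]
  · set g := ∇ f x - ∇ f y with hg
    have h1 := h.bregman_nonneg (x - L⁻¹ • g) y
    rw [bregman_three_point f _ x y, ← hg] at h1
    have h2 := h.bregman_le (x - L⁻¹ • g) x
    have h3 : x - L⁻¹ • g - x = -(L⁻¹ • g) := by abel
    rw [h3, norm_neg, norm_smul, Real.norm_of_nonneg (inv_nonneg.2 hL.le)] at h2
    rw [h3, inner_neg_right, inner_smul_right, real_inner_self_eq_norm_sq] at h1
    have h4 : L / 2 * (L⁻¹ * ‖g‖) ^ 2 = L⁻¹ * ‖g‖ ^ 2 / 2 := by field_simp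
    have h5 : L⁻¹ * ‖g‖ ^ 2 ≤ 2 * bregman f x y := by linarith
    have h6 := mul_le_mul_of_nonneg_left h5 hL.le
    rw [mul_inv_cancel_left₀ hL.ne'] at h6
    linarith

theorem sum_apply_update {ι E M : Type*} [Fintype ι] [DecidableEq ι] [AddCommGroup M]
    (φ : ι → E → M) (v : ι → E) (i : ι) (a : E) :
    ∑ x, φ x (Function.update v i a x) = ∑ x, φ x (v x) - φ i (v i) + φ i a := by
  rw [← Finset.add_sum_erase _ _ (Finset.mem_univ i),
    ← Finset.add_sum_erase Finset.univ (fun x => φ x (v x)) (Finset.mem_univ i)]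
  have h : ∑ x ∈ Finset.univ.erase i, φ x (Function.update v i a x)
      = ∑ x ∈ Finset.univ.erase i, φ x (v x) :=
    Finset.sum_congr rfl fun x hx => by
      rw [Function.update_of_ne (Finset.ne_of_mem_erase hx)]
  rw [h, Function.update_self]
  abel

/-! ### Flows on the complete bipartite graph -/

section Flow
variable {E : Type*} [NormedAddCommGroup E] {n K : ℕ}

/-- The squared norm of the smallest flow on the edges of the complete bipartite graph with
marginals `v` and `w`. -/
def flowSq (v : Fin n → E) (w : Fin K → E) : ℝ :=
  (1 / (K : ℝ)) * ∑ i, ‖v i‖ ^ 2 + (1 / (n : ℝ)) * ∑ k, ‖w k‖ ^ 2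
    - (1 / ((n : ℝ) * K)) * ‖∑ k, w k‖ ^ 2

theorem flowSq_le (v : Fin n → E) (w : Fin K → E) :
    flowSq v w ≤ (1 / (K : ℝ)) * ∑ i, ‖v i‖ ^ 2 + (1 / (n : ℝ)) * ∑ k, ‖w k‖ ^ 2 := by
  unfold flowSq
  have : 0 ≤ (1 / ((n : ℝ) * K)) * ‖∑ k, w k‖ ^ 2 := by positivity
  linarith

theorem flowSq_nonneg [NeZero K] (v : Fin n → E) (w : Fin K → E) : 0 ≤ flowSq v w := by
  have hK : (0 : ℝ) < K := by exact_mod_cast Nat.pos_of_ne_zero (NeZero.ne K)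
  have h1 : ‖∑ k, w k‖ ^ 2 ≤ K * ∑ k, ‖w k‖ ^ 2 := by
    calc ‖∑ k, w k‖ ^ 2 ≤ (∑ k, ‖w k‖) ^ 2 := by gcongr; exact norm_sum_le _ _
      _ ≤ _ := by simpa using sq_sum_le_card_mul_sum_sq (s := Finset.univ) (f := fun k => ‖w k‖)
  have h2 : (1 / ((n : ℝ) * K)) * ‖∑ k, w k‖ ^ 2 ≤ (1 / (n : ℝ)) * ∑ k, ‖w k‖ ^ 2 := by
    calc (1 / ((n : ℝ) * K)) * ‖∑ k, w k‖ ^ 2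
        ≤ (1 / ((n : ℝ) * K)) * (K * ∑ k, ‖w k‖ ^ 2) := by gcongr
      _ = _ := by
        rw [← mul_assoc, show (1 / ((n : ℝ) * K)) * K = 1 / n by field_simp]
  have h3 : 0 ≤ (1 / (K : ℝ)) * ∑ i, ‖v i‖ ^ 2 := by positivity
  unfold flowSq
  linarith

variable [InnerProductSpace ℝ E]

/-- The smallest flow with marginals `v` and `w`. -/
def edgeFlow (v : Fin n → E) (w : Fin K → E) (k : Fin K) (i : Fin n) : E :=
  (1 / (K : ℝ)) • v i + (1 / (n : ℝ)) • w k - (1 / ((n : ℝ) * K)) • ∑ k, w k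

/-- `edgeFlow` is half the gradient of `flowSq` in the direction of the edge $(k,i)$. The
coefficient of $\|g\|^2$ is the squared norm of the smallest flow carrying one unit from $i$ to $k$.
-/
theorem flowSq_update (v : Fin n → E) (w : Fin K → E) (k : Fin K) (i : Fin n) (g : E) :
    flowSq (Function.update v i (v i + g)) (Function.update w k (w k + g))
      = flowSq v w + 2 * inner ℝ (edgeFlow v w k i) g
        + (1 / (K : ℝ) + 1 / n - 1 / (n * K)) * ‖g‖ ^ 2 := by
  have hS : ∑ k', Function.update w k (w k + g) k' = ∑ k', w k' + g := by
    rw [sum_apply_update (fun _ x => x)]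
    abel
  unfold flowSq edgeFlow
  rw [sum_apply_update (fun _ x => ‖x‖ ^ 2), sum_apply_update (fun _ x => ‖x‖ ^ 2), hS,
    norm_add_sq_real, norm_add_sq_real, norm_add_sq_real, inner_sub_left, inner_add_left,
    real_inner_smul_left, real_inner_smul_left, real_inner_smul_left]
  ring

theorem sum_edgeFlow_node [NeZero n] [NeZero K] {v : Fin n → E} {w : Fin K → E}
    (h : ∑ i, v i = ∑ k, w k) (k : Fin K) : ∑ i, edgeFlow v w k i = w k := by
  have hn : (n : ℝ) ≠ 0 := by exact_mod_cast NeZero.ne n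
  have hK : (K : ℝ) ≠ 0 := by exact_mod_cast NeZero.ne K
  simp only [edgeFlow, Finset.sum_sub_distrib, Finset.sum_add_distrib, ← Finset.smul_sum, h,
    Finset.sum_const, Finset.card_univ, Fintype.card_fin, ← Nat.cast_smul_eq_nsmul ℝ, smul_smul]
  rw [one_div_mul_cancel hn, show (1 / ((n : ℝ) * K)) * n = 1 / K by field_simp]
  simp

theorem sum_edgeFlow_token [NeZero K] (v : Fin n → E) (w : Fin K → E) (i : Fin n) :
    ∑ k, edgeFlow v w k i = v i := by
  have hK : (K : ℝ) ≠ 0 := by exact_mod_cast NeZero.ne K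
  simp only [edgeFlow, Finset.sum_sub_distrib, Finset.sum_add_distrib, ← Finset.smul_sum,
    Finset.sum_const, Finset.card_univ, Fintype.card_fin, ← Nat.cast_smul_eq_nsmul ℝ, smul_smul]
  rw [one_div_mul_cancel hK, show (1 / ((n : ℝ) * K)) * K = 1 / n by field_simp]
  simp

end Flow

/-! ### The Lyapunov function -/

section Lyapunov
variable {n m K d : ℕ}

/-- Deviation of the gradients from their values at `θstar`. -/
def gradDev (f : Fin n → Fin m → Vec d → ℝ) (θstar : Vec d) (s : State n m K d)
    (i : Fin n) (j : Fin m) : Vec d :=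
  ∇ (f i j) (s.z i j) - ∇ (f i j) θstar

/-- Total flow out of a node, relative to its optimal value. -/
def nodeFlow (f : Fin n → Fin m → Vec d → ℝ) (P : Params n m) (θstar : Vec d)
    (s : State n m K d) (i : Fin n) : Vec d :=
  -(P.σt • (s.node i - θstar)) - ∑ j, gradDev f θstar s i j

/-- Total flow into a token, relative to its optimal value. -/
def tokenFlow (P : Params n m) (θstar : Vec d) (s : State n m K d) (k : Fin K) : Vec d :=
  P.σt • (s.token k - θstar)

/-- The flows out of the nodes and into the tokens have the same total. -/
def Balanced (f : Fin n → Fin m → Vec d → ℝ) (P : Params n m) (θstar : Vec d)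
    (s : State n m K d) : Prop :=
  ∑ i, nodeFlow f P θstar s i = ∑ k, tokenFlow P θstar s k

/-- Suboptimality of the dual objective. -/
def dualGap (f : Fin n → Fin m → Vec d → ℝ) (P : Params n m) (θstar : Vec d)
    (s : State n m K d) : ℝ :=
  P.σt / 2 * sqError θstar s + ∑ i, ∑ j, bregman (f i j) θstar (s.z i j)

/-- Bregman divergences of the virtual nodes from the optimum. -/
def virtualDiv (f : Fin n → Fin m → Vec d → ℝ) (θstar : Vec d) (s : State n m K d) : ℝ :=
  ∑ i, ∑ j, bregman (f i j) (s.z i j) θstar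

/-- The Lyapunov function: the dual suboptimality plus a multiple of the divergence of the
dual variable from the optimum. -/
def lyapunov (f : Fin n → Fin m → Vec d → ℝ) (P : Params n m) (θstar : Vec d) (α μ : ℝ)
    (s : State n m K d) : ℝ :=
  μ * (flowSq (nodeFlow f P θstar s) (tokenFlow P θstar s) / 2 + 1 / α * virtualDiv f θstar s)
    + dualGap f P θstar s

/-- Conditions on the parameters under which the Lyapunov function contracts. -/
structure Admissible (K : ℕ) (f : Fin n → Fin m → Vec d → ℝ) (L : Fin n → Fin m → ℝ)
    (P : Params n m) (θstar : Vec d) (α μ η : ℝ) : Prop where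
  smooth : ∀ i j, ConvexSmooth (f i j) (L i j)
  L_nonneg : ∀ i j, 0 ≤ L i j
  K_le : K ≤ n
  optimal : ((n : ℝ) + K) • P.σt • θstar + ∑ i, ∑ j, ∇ (f i j) θstar = 0
  σt_pos : 0 < P.σt
  μ_pos : 0 < μ
  η_pos : 0 < η
  -- The next two bounds put $\mu/\alpha$ in $[\frac14,\frac12]$, so the virtual divergences enter
  -- `lyapunov` with a weight of constant order.
  two_mul_μ_le : 2 * μ ≤ α
  α_le : α ≤ 4 * μ
  μ_mul_le : ∀ i, μ * (P.σt + ∑ j, L i j) ≤ K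
  ρcomm_pos : 0 < P.ρcomm
  ρcomm_le : P.ρcomm ≤ 1 / 2
  -- An edge has probability `pcomm / (n * K)` under uniform landing, so probability times dual step
  -- is $\eta$; by `ρcomp_eq` it is $\alpha\eta$ for every virtual node. The expected step is thus
  -- the same in all coordinates.
  ρcomm_eq : P.pcomm * (P.ρcomm * P.σt) = n * K * η
  ρcomp_pos : ∀ i j, 0 < P.ρcomp i j
  ρcomp_le : ∀ i j, P.ρcomp i j * (1 + L i j / P.σt) ≤ 1
  ρcomp_eq : ∀ i j, (1 - P.pcomm) * (P.q i j * P.ρcomp i j) = n * (α * η)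

variable {f : Fin n → Fin m → Vec d → ℝ} {L : Fin n → Fin m → ℝ} {P : Params n m}
  {θstar : Vec d} {α μ η : ℝ}

theorem Admissible.α_pos (h : Admissible K f L P θstar α μ η) : 0 < α := by
  linarith [h.two_mul_μ_le, h.μ_pos]

theorem sqError_nonneg (θstar : Vec d) (s : State n m K d) : 0 ≤ sqError θstar s := by
  unfold sqError
  positivity

theorem Admissible.virtualDiv_nonneg (h : Admissible K f L P θstar α μ η) (s : State n m K d) :
    0 ≤ virtualDiv f θstar s :=
  Finset.sum_nonneg fun i _ => Finset.sum_nonneg fun j _ => (h.smooth i j).bregman_nonneg _ _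

theorem Admissible.le_dualGap (h : Admissible K f L P θstar α μ η) (s : State n m K d) :
    P.σt / 2 * sqError θstar s ≤ dualGap f P θstar s :=
  le_add_of_nonneg_right (Finset.sum_nonneg fun i _ => Finset.sum_nonneg fun j _ =>
    (h.smooth i j).bregman_nonneg _ _)

theorem Admissible.dualGap_nonneg (h : Admissible K f L P θstar α μ η) (s : State n m K d) :
    0 ≤ dualGap f P θstar s :=
  (mul_nonneg (by linarith [h.σt_pos]) (sqError_nonneg _ _)).trans (h.le_dualGap s)

/-- The virtual divergences are controlled by the Lyapunov function. -/
theorem Admissible.virtualDiv_le [NeZero K] (h : Admissible K f L P θstar α μ η)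
    (s : State n m K d) : virtualDiv f θstar s + 4 * dualGap f P θstar s
      ≤ 4 * lyapunov f P θstar α μ s := by
  have h1 : 1 / 4 ≤ μ * (1 / α) := by
    rw [mul_one_div, le_div_iff₀ h.α_pos]
    linarith [h.α_le]
  have h2 := mul_le_mul_of_nonneg_right h1 (h.virtualDiv_nonneg s)
  have h3 := mul_nonneg h.μ_pos.le
    (flowSq_nonneg (nodeFlow f P θstar s) (tokenFlow P θstar s))
  unfold lyapunov
  linarith

theorem Admissible.dualGap_le [NeZero K] (h : Admissible K f L P θstar α μ η)
    (s : State n m K d) : dualGap f P θstar s ≤ lyapunov f P θstar α μ s := by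
  linarith [h.virtualDiv_le s, h.virtualDiv_nonneg s]

theorem Admissible.lyapunov_nonneg [NeZero K] (h : Admissible K f L P θstar α μ η)
    (s : State n m K d) : 0 ≤ lyapunov f P θstar α μ s :=
  (h.dualGap_nonneg s).trans (h.dualGap_le s)

theorem Admissible.sqError_le [NeZero K] (h : Admissible K f L P θstar α μ η)
    (s : State n m K d) : sqError θstar s ≤ 2 / P.σt * lyapunov f P θstar α μ s := by
  have h1 := (h.le_dualGap s).trans (h.dualGap_le s)
  rw [div_mul_eq_mul_div, le_div_iff₀ h.σt_pos]
  linarith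

/-- Cauchy–Schwarz weighted by the smoothness constants of the terms at node `i`; in `Option (Fin
m)`, `none` stands for the quadratic term. Each gradient deviation is bounded by cocoercivity. -/
theorem Admissible.sq_norm_nodeFlow_le (h : Admissible K f L P θstar α μ η)
    (s : State n m K d) (i : Fin n) :
    ‖nodeFlow f P θstar s i‖ ^ 2 ≤ (P.σt + ∑ j, L i j) *
      (P.σt * ‖s.node i - θstar‖ ^ 2 + 2 * ∑ j, bregman (f i j) (s.z i j) θstar) := by
  have hσ := h.σt_pos.le
  have h1 : ‖nodeFlow f P θstar s i‖
      ≤ ∑ o : Option (Fin m), o.elim (P.σt * ‖s.node i - θstar‖)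
          (fun j => ‖gradDev f θstar s i j‖) := by
    rw [Fintype.sum_option]
    refine (norm_sub_le _ _).trans (add_le_add ?_ (norm_sum_le _ _))
    rw [norm_neg, norm_smul, Real.norm_of_nonneg hσ]
    rfl
  have h2 := Finset.sum_sq_le_sum_mul_sum_of_sq_le_mul (Finset.univ : Finset (Option (Fin m)))
    (r := fun o => o.elim (P.σt * ‖s.node i - θstar‖) (fun j => ‖gradDev f θstar s i j‖))
    (f := fun o => o.elim P.σt (L i))
    (g := fun o => o.elim (P.σt * ‖s.node i - θstar‖ ^ 2)
      (fun j => 2 * bregman (f i j) (s.z i j) θstar))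
    (by
      rintro (_ | j) -
      · exact hσ
      · exact h.L_nonneg i j)
    (by
      rintro (_ | j) -
      · exact mul_nonneg hσ (sq_nonneg _)
      · exact mul_nonneg zero_le_two ((h.smooth i j).bregman_nonneg _ _))
    (by
      rintro (_ | j) -
      · exact le_of_eq (by simp only [Option.elim]; ring)
      · have := (h.smooth i j).sq_norm_gradient_sub_le (h.L_nonneg i j) (s.z i j) θstar
        simp only [Option.elim, gradDev]
        linarith)
  refine (pow_le_pow_left₀ (norm_nonneg _) h1 2).trans (h2.trans (le_of_eq ?_))
  simp only [Fintype.sum_option, Option.elim, ← Finset.mul_sum]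

/-- Relative strong convexity of the dual. The node marginals enter `flowSq` with weight $1/K$,
matched by `μ_mul_le`; the token marginals have weight $1/n$, which is no larger because $K\le n$.
-/
theorem Admissible.μ_mul_flowSq_le [NeZero n] [NeZero K] (h : Admissible K f L P θstar α μ η)
    (s : State n m K d) :
    μ * flowSq (nodeFlow f P θstar s) (tokenFlow P θstar s)
      ≤ P.σt * sqError θstar s + 2 * virtualDiv f θstar s := by
  have hn : (0 : ℝ) < n := by exact_mod_cast Nat.pos_of_ne_zero (NeZero.ne n)
  have hK : (0 : ℝ) < K := by exact_mod_cast Nat.pos_of_ne_zero (NeZero.ne K)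
  have hKn : (K : ℝ) ≤ n := by exact_mod_cast h.K_le
  have hσ := h.σt_pos
  have h1 : μ * ((1 / (K : ℝ)) * ∑ i, ‖nodeFlow f P θstar s i‖ ^ 2)
      ≤ ∑ i, (P.σt * ‖s.node i - θstar‖ ^ 2
        + 2 * ∑ j, bregman (f i j) (s.z i j) θstar) := by
    rw [Finset.mul_sum, Finset.mul_sum]
    refine Finset.sum_le_sum fun i _ => ?_
    have hB : 0 ≤ P.σt * ‖s.node i - θstar‖ ^ 2
        + 2 * ∑ j, bregman (f i j) (s.z i j) θstar :=
      add_nonneg (mul_nonneg hσ.le (sq_nonneg _)) (mul_nonneg zero_le_two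
        (Finset.sum_nonneg fun j _ => (h.smooth i j).bregman_nonneg _ _))
    calc μ * (1 / (K : ℝ) * ‖nodeFlow f P θstar s i‖ ^ 2)
        ≤ μ * (1 / (K : ℝ) * ((P.σt + ∑ j, L i j) * (P.σt * ‖s.node i - θstar‖ ^ 2
        + 2 * ∑ j, bregman (f i j) (s.z i j) θstar))) := by
          have := h.μ_pos
          gcongr
          exact h.sq_norm_nodeFlow_le s i
      _ = (μ * (P.σt + ∑ j, L i j) / K) * (P.σt * ‖s.node i - θstar‖ ^ 2
        + 2 * ∑ j, bregman (f i j) (s.z i j) θstar) := by ring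
      _ ≤ 1 * _ := by
          gcongr
          exact (div_le_one hK).2 (h.μ_mul_le i)
      _ = _ := one_mul _
  have hμσ : μ * P.σt ≤ n := by
    have h2 := h.μ_mul_le 0
    have h3 : 0 ≤ μ * ∑ j, L 0 j :=
      mul_nonneg h.μ_pos.le (Finset.sum_nonneg fun j _ => h.L_nonneg 0 j)
    linarith
  have h2 : μ * ((1 / (n : ℝ)) * ∑ k, ‖tokenFlow P θstar s k‖ ^ 2)
      ≤ P.σt * ∑ k, ‖s.token k - θstar‖ ^ 2 := by
    simp only [tokenFlow, norm_smul, mul_pow, Real.norm_of_nonneg hσ.le, ← Finset.mul_sum]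
    calc μ * (1 / (n : ℝ) * (P.σt ^ 2 * ∑ k, ‖s.token k - θstar‖ ^ 2))
        = (μ * P.σt / n) * (P.σt * ∑ k, ‖s.token k - θstar‖ ^ 2) := by ring
      _ ≤ 1 * _ := by
          gcongr
          exact (div_le_one hn).2 hμσ
      _ = _ := one_mul _
  have h3 := mul_le_mul_of_nonneg_left
    (flowSq_le (nodeFlow f P θstar s) (tokenFlow P θstar s)) h.μ_pos.le
  simp only [Finset.sum_add_distrib, ← Finset.mul_sum] at h1
  unfold sqError virtualDiv
  linarith

theorem Admissible.lyapunov_le [NeZero n] [NeZero K] (h : Admissible K f L P θstar α μ η)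
    (s : State n m K d) :
    lyapunov f P θstar α μ s ≤ P.σt / 2 * sqError θstar s + 3 / 2 * virtualDiv f θstar s
      + dualGap f P θstar s := by
  have h1 : μ * (1 / α) ≤ 1 / 2 := by
    rw [mul_one_div, div_le_iff₀ h.α_pos]
    linarith [h.two_mul_μ_le]
  have h2 := mul_le_mul_of_nonneg_right h1 (h.virtualDiv_nonneg s)
  have h3 := h.μ_mul_flowSq_le s
  unfold lyapunov
  linarith

end Lyapunov

/-! ### Change of the Lyapunov function in one iteration -/

section OneStep
variable {n m K d : ℕ} {f : Fin n → Fin m → Vec d → ℝ} {L : Fin n → Fin m → ℝ} {P : Params n m}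
  {θstar : Vec d} {α μ η : ℝ}

theorem nodeFlow_commUpdate (N : ℕ) (s : State n m K d) (k : Fin K) (i : Fin n) :
    nodeFlow f P θstar (commUpdate P N s k i)
      = Function.update (nodeFlow f P θstar s) i
          (nodeFlow f P θstar s i + -((P.ρcomm * P.σt) • (s.token k - s.node i))) := by
  funext i'
  rcases eq_or_ne i' i with rfl | hi
  · simp only [nodeFlow, commUpdate, gradDev, Function.update_self]
    module
  · simp only [nodeFlow, commUpdate, gradDev, Function.update_of_ne hi]

theorem tokenFlow_commUpdate (N : ℕ) (s : State n m K d) (k : Fin K) (i : Fin n) :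
    tokenFlow P θstar (commUpdate P N s k i)
      = Function.update (tokenFlow P θstar s) k
          (tokenFlow P θstar s k + -((P.ρcomm * P.σt) • (s.token k - s.node i))) := by
  funext k'
  rcases eq_or_ne k' k with rfl | hk
  · simp only [tokenFlow, commUpdate, Function.update_self]
    module
  · simp only [tokenFlow, commUpdate, Function.update_of_ne hk]

/-- The changes of the node parameter and of the stored gradient cancel: a gradient step moves a
virtual coordinate only. -/
theorem nodeFlow_compUpdate (hσ : P.σt ≠ 0) (s : State n m K d) (i : Fin n) (j : Fin m) :
    nodeFlow f P θstar (compUpdate f P s i j) = nodeFlow f P θstar s := by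
  funext i'
  rcases eq_or_ne i' i with rfl | hi
  · simp only [nodeFlow, compUpdate, gradDev, Function.update_self]
    rw [sum_apply_update (fun j x => ∇ (f i' j) x - ∇ (f i' j) θstar), smul_sub, smul_sub,
      smul_smul, mul_one_div_cancel hσ, smul_sub]
    module
  · simp only [nodeFlow, compUpdate, gradDev, Function.update_of_ne hi]

theorem tokenFlow_compUpdate (s : State n m K d) (i : Fin n) (j : Fin m) :
    tokenFlow P θstar (compUpdate f P s i j) = tokenFlow P θstar s := rfl

theorem Balanced.commUpdate {s : State n m K d} (h : Balanced f P θstar s) (N : ℕ) (k : Fin K)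
    (i : Fin n) : Balanced f P θstar (commUpdate P N s k i) := by
  unfold Balanced at *
  rw [nodeFlow_commUpdate, tokenFlow_commUpdate, sum_apply_update (fun _ x => x),
    sum_apply_update (fun _ x => x), h]
  abel

theorem Balanced.compUpdate {s : State n m K d} (h : Balanced f P θstar s) (hσ : P.σt ≠ 0)
    (i : Fin n) (j : Fin m) : Balanced f P θstar (compUpdate f P s i j) := by
  unfold Balanced at *
  rw [nodeFlow_compUpdate hσ, tokenFlow_compUpdate, h]

theorem dualGap_commUpdate (N : ℕ) (s : State n m K d) (k : Fin K) (i : Fin n) :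
    dualGap f P θstar (commUpdate P N s k i) = dualGap f P θstar s
      - P.σt * (P.ρcomm * (1 - P.ρcomm)) * ‖s.token k - s.node i‖ ^ 2 := by
  simp only [dualGap, sqError, commUpdate]
  rw [sum_apply_update (fun _ x => ‖x - θstar‖ ^ 2), sum_apply_update (fun _ x => ‖x - θstar‖ ^ 2)]
  set a := s.node i - θstar with ha
  set δ := s.token k - s.node i with hδ
  have h1 : s.node i + P.ρcomm • δ - θstar = a + P.ρcomm • δ := by rw [ha]; abel
  have h2 : s.token k - P.ρcomm • δ - θstar = a + (1 - P.ρcomm) • δ := by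
    rw [ha, sub_smul, one_smul, hδ]; abel
  have h3 : s.token k - θstar = a + δ := by rw [ha, hδ]; abel
  rw [h1, h2, h3, norm_add_sq_real, norm_add_sq_real, norm_add_sq_real, norm_smul, norm_smul,
    inner_smul_right, inner_smul_right, mul_pow, mul_pow, Real.norm_eq_abs, Real.norm_eq_abs,
    sq_abs, sq_abs]
  ring

theorem Admissible.μ_mul_σt_le [NeZero n] (h : Admissible K f L P θstar α μ η) :
    μ * P.σt ≤ K := by
  have h2 := h.μ_mul_le 0
  have h3 : 0 ≤ μ * ∑ j, L 0 j :=
    mul_nonneg h.μ_pos.le (Finset.sum_nonneg fun j _ => h.L_nonneg 0 j)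
  linarith

/-- Averaging lowers the dual gap by a multiple of $\|\tau^{(k)}-\theta^{(i)}\|^2$. Since $\rho_{\rm
comm}\le\frac12$ and $\mu\tilde\sigma\le K$, this pays for the quadratic term of `flowSq_update`,
and only the linear term is left. -/
theorem Admissible.lyapunov_commUpdate_le [NeZero n] [NeZero K]
    (h : Admissible K f L P θstar α μ η) (N : ℕ) (s : State n m K d) (k : Fin K) (i : Fin n) :
    lyapunov f P θstar α μ (TokenAlg.commUpdate P N s k i) ≤ lyapunov f P θstar α μ s
      - μ * (P.ρcomm * P.σt) * inner ℝ (edgeFlow (nodeFlow f P θstar s) (tokenFlow P θstar s) k i)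
          (s.token k - s.node i) := by
  have hn : (0 : ℝ) < n := by exact_mod_cast Nat.pos_of_ne_zero (NeZero.ne n)
  have hK : (0 : ℝ) < K := by exact_mod_cast Nat.pos_of_ne_zero (NeZero.ne K)
  have hKn : (K : ℝ) ≤ n := by exact_mod_cast h.K_le
  have hσ := h.σt_pos
  have hρ := h.ρcomm_pos
  have hV : virtualDiv f θstar (TokenAlg.commUpdate P N s k i) = virtualDiv f θstar s := rfl
  unfold lyapunov
  rw [nodeFlow_commUpdate, tokenFlow_commUpdate, flowSq_update, dualGap_commUpdate, hV,
    inner_neg_right, inner_smul_right, norm_neg, norm_smul, mul_pow, Real.norm_eq_abs, sq_abs]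
  have h1 : (1 / (K : ℝ) + 1 / n - 1 / (n * K)) ≤ 2 / K := by
    have h2 : 1 / (n : ℝ) ≤ 1 / K := one_div_le_one_div_of_le hK hKn
    have h3 : 0 ≤ 1 / ((n : ℝ) * K) := by positivity
    have h4 : 2 / (K : ℝ) = 1 / K + 1 / K := by ring
    linarith
  have h2 : μ * ((1 / (K : ℝ) + 1 / n - 1 / (n * K))
        * ((P.ρcomm * P.σt) ^ 2 * ‖s.token k - s.node i‖ ^ 2) / 2)
      ≤ P.σt * (P.ρcomm * (1 - P.ρcomm)) * ‖s.token k - s.node i‖ ^ 2 := by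
    have hμ := h.μ_pos
    calc _ ≤ μ * (2 / K * ((P.ρcomm * P.σt) ^ 2 * ‖s.token k - s.node i‖ ^ 2) / 2) := by gcongr
      _ = (μ * P.σt / K) * (P.σt * (P.ρcomm * P.ρcomm) * ‖s.token k - s.node i‖ ^ 2) := by ring
      _ ≤ 1 * (P.σt * (P.ρcomm * P.ρcomm) * ‖s.token k - s.node i‖ ^ 2) := by
        gcongr
        exact (div_le_one hK).2 h.μ_mul_σt_le
      _ ≤ _ := by
        rw [one_mul]
        gcongr
        linarith [h.ρcomm_le]
  linarith

/-- A crude bound valid for every landing node, used for the non-uniform part of the landing law: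
averaging leaves the virtual divergences unchanged and does not increase the dual gap, and together
these control `lyapunov`. -/
theorem Admissible.lyapunov_commUpdate_le_mul [NeZero n] [NeZero K]
    (h : Admissible K f L P θstar α μ η) (N : ℕ) (s : State n m K d) (k : Fin K) (i : Fin n) :
    lyapunov f P θstar α μ (TokenAlg.commUpdate P N s k i) ≤ 8 * lyapunov f P θstar α μ s := by
  have h1 := h.lyapunov_le (TokenAlg.commUpdate P N s k i)
  have h2 := h.le_dualGap (TokenAlg.commUpdate P N s k i)
  have hV : virtualDiv f θstar (TokenAlg.commUpdate P N s k i) = virtualDiv f θstar s := rfl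
  rw [hV] at h1
  have h3 : dualGap f P θstar (TokenAlg.commUpdate P N s k i) ≤ dualGap f P θstar s := by
    rw [dualGap_commUpdate]
    have hρ : 0 ≤ 1 - P.ρcomm := by linarith [h.ρcomm_le]
    have := h.σt_pos
    have := h.ρcomm_pos
    have : 0 ≤ P.σt * (P.ρcomm * (1 - P.ρcomm)) * ‖s.token k - s.node i‖ ^ 2 := by positivity
    linarith
  linarith [h.virtualDiv_le s, h.dualGap_nonneg s, h.lyapunov_nonneg s]

theorem newZ_sub (P : Params n m) (s : State n m K d) (i : Fin n) (j : Fin m) :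
    newZ P s i j - s.z i j = -(P.ρcomp i j • (s.z i j - s.node i)) := by
  unfold newZ
  module

theorem dualGap_compUpdate (hσ : P.σt ≠ 0) (s : State n m K d) (i : Fin n) (j : Fin m) :
    dualGap f P θstar (compUpdate f P s i j) = dualGap f P θstar s
      + inner ℝ (∇ (f i j) (newZ P s i j) - ∇ (f i j) (s.z i j)) (s.z i j - s.node i)
      + bregman (f i j) (s.z i j) (newZ P s i j)
      + 1 / (2 * P.σt) * ‖∇ (f i j) (newZ P s i j) - ∇ (f i j) (s.z i j)‖ ^ 2 := by
  simp only [dualGap, sqError, compUpdate]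
  rw [sum_apply_update (fun _ x => ‖x - θstar‖ ^ 2),
    sum_apply_update (fun i (x : Fin m → Vec d) => ∑ j, bregman (f i j) θstar (x j)),
    sum_apply_update (fun j x => bregman (f i j) θstar x)]
  set g := ∇ (f i j) (newZ P s i j) - ∇ (f i j) (s.z i j) with hg
  have h1 : s.node i - (1 / P.σt) • g - θstar = (s.node i - θstar) - (1 / P.σt) • g := by abel
  have h2 := bregman_three_point (f i j) θstar (s.z i j) (newZ P s i j)
  have h3 : ∇ (f i j) (s.z i j) - ∇ (f i j) (newZ P s i j) = -g := by rw [hg]; abel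
  have h4 : s.z i j - s.node i = (s.z i j - θstar) - (s.node i - θstar) := by abel
  have h5 : θstar - s.z i j = -(s.z i j - θstar) := by abel
  rw [h1, norm_sub_sq_real (s.node i - θstar) ((1 / P.σt) • g), inner_smul_right, norm_smul,
    mul_pow, Real.norm_eq_abs, sq_abs, h2,
    h3, h4, h5, inner_neg_neg, inner_sub_right g (s.z i j - θstar) (s.node i - θstar),
    real_inner_comm (s.node i - θstar) g]
  field_simp
  ring

theorem virtualDiv_compUpdate (s : State n m K d) (i : Fin n) (j : Fin m) :
    virtualDiv f θstar (compUpdate f P s i j) = virtualDiv f θstar s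
      + bregman (f i j) (newZ P s i j) (s.z i j)
      - P.ρcomp i j * inner ℝ (gradDev f θstar s i j) (s.z i j - s.node i) := by
  simp only [virtualDiv, compUpdate]
  rw [sum_apply_update (fun i (x : Fin m → Vec d) => ∑ j, bregman (f i j) (x j) θstar),
    sum_apply_update (fun j x => bregman (f i j) x θstar),
    bregman_three_point (f i j) (newZ P s i j) (s.z i j) θstar, newZ_sub, inner_neg_right,
    inner_smul_right]
  unfold gradDev
  ring

/-- The analogue for a virtual coordinate. The symmetrized Bregman divergence between `z'` and `z`
equals the linear decrease of the dual gap times $\rho_{ij}$, so a small $\rho_{ij}$ pays for the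
remaining divergences and, by cocoercivity, for the squared gradient difference. -/
theorem Admissible.lyapunov_compUpdate_le (h : Admissible K f L P θstar α μ η)
    (s : State n m K d) (i : Fin n) (j : Fin m) :
    lyapunov f P θstar α μ (TokenAlg.compUpdate f P s i j) ≤ lyapunov f P θstar α μ s
      - μ / α * P.ρcomp i j * inner ℝ (gradDev f θstar s i j) (s.z i j - s.node i) := by
  have hσ := h.σt_pos
  have hρ := h.ρcomp_pos i j
  have hα := h.α_pos
  unfold lyapunov
  rw [nodeFlow_compUpdate hσ.ne', tokenFlow_compUpdate, dualGap_compUpdate hσ.ne',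
    virtualDiv_compUpdate]
  set z := s.z i j
  set z' := newZ P s i j with hz'
  set B := bregman (f i j) z' z
  set B' := bregman (f i j) z z' with hB'
  have hB : 0 ≤ B := (h.smooth i j).bregman_nonneg _ _
  have hB'0 : 0 ≤ B' := (h.smooth i j).bregman_nonneg _ _
  have h1 : B + B' = -(P.ρcomp i j
      * inner ℝ (∇ (f i j) z' - ∇ (f i j) z) (z - s.node i)) := by
    rw [bregman_add_bregman, hz', newZ_sub, inner_neg_right, inner_smul_right]
  have h2 : ‖∇ (f i j) z' - ∇ (f i j) z‖ ^ 2 ≤ 2 * L i j * B' := by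
    rw [norm_sub_rev]
    exact (h.smooth i j).sq_norm_gradient_sub_le (h.L_nonneg i j) z z'
  have h3 : 1 / (2 * P.σt) * ‖∇ (f i j) z' - ∇ (f i j) z‖ ^ 2 ≤ L i j / P.σt * B' := by
    calc _ ≤ 1 / (2 * P.σt) * (2 * L i j * B') := by gcongr
      _ = _ := by field_simp
  have hLσ : 0 ≤ L i j / P.σt := div_nonneg (h.L_nonneg i j) hσ.le
  have hρ1 : P.ρcomp i j ≤ 1 := by nlinarith [h.ρcomp_le i j]
  set I := inner ℝ (∇ (f i j) z' - ∇ (f i j) z) (z - s.node i)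
  -- By `ρcomp_le` and `hρ1` the left side is at most $\rho I+B'+B$, which vanishes by `h1`.
  have h4 : P.ρcomp i j * (I + (1 + L i j / P.σt) * B' + B) ≤ 0 := by
    have := mul_le_mul_of_nonneg_right (h.ρcomp_le i j) hB'0
    have := mul_le_mul_of_nonneg_right hρ1 hB
    nlinarith
  have h5 : I + (1 + L i j / P.σt) * B' + B ≤ 0 := by
    by_contra hc
    exact absurd h4 (not_le.2 (mul_pos hρ (not_le.1 hc)))
  have h6 : μ * (1 / α) * B ≤ 1 * B := by
    gcongr
    rw [mul_one_div, div_le_one hα]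
    linarith [h.two_mul_μ_le, h.μ_pos]
  have h7 : μ * (1 / α) = μ / α := by ring
  rw [h7] at h6
  have h8 : ∀ x y z w : ℝ, μ * (x + 1 / α * (y + z - w)) = μ * (x + 1 / α * y) + μ / α * z
      - μ / α * w := by
    intros; ring
  rw [h8]
  linarith

/-- Measure all parameters from $\theta_\star$ and sum the edge flows to their marginals; balance is
what makes the token marginals correct. The terms pairing `gradDev` with the node parameters cancel,
leaving squares and symmetrized Bregman divergences. -/
theorem Balanced.sum_inner_eq [NeZero n] [NeZero K] {s : State n m K d}
    (hs : Balanced f P θstar s) :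
    ∑ k, ∑ i, inner ℝ (edgeFlow (nodeFlow f P θstar s) (tokenFlow P θstar s) k i)
        (s.token k - s.node i)
      + ∑ i, ∑ j, inner ℝ (gradDev f θstar s i j) (s.z i j - s.node i)
      = P.σt / 2 * sqError θstar s + virtualDiv f θstar s + dualGap f P θstar s := by
  have h1 : ∀ k i, inner ℝ (edgeFlow (nodeFlow f P θstar s) (tokenFlow P θstar s) k i)
      (s.token k - s.node i)
      = inner ℝ (edgeFlow (nodeFlow f P θstar s) (tokenFlow P θstar s) k i) (s.token k - θstar)
      - inner ℝ (edgeFlow (nodeFlow f P θstar s) (tokenFlow P θstar s) k i)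
        (s.node i - θstar) := fun k i => by
    rw [← inner_sub_right]
    congr 1
    abel
  have h2 : ∀ i j, inner ℝ (gradDev f θstar s i j) (s.z i j - s.node i)
      = bregman (f i j) (s.z i j) θstar + bregman (f i j) θstar (s.z i j)
        - inner ℝ (gradDev f θstar s i j) (s.node i - θstar) := fun i j => by
    rw [bregman_add_bregman]
    unfold gradDev
    rw [← inner_sub_right]
    congr 1
    abel
  have h3 : ∀ i, inner ℝ (nodeFlow f P θstar s i) (s.node i - θstar)
      = -(P.σt * ‖s.node i - θstar‖ ^ 2)
        - ∑ j, inner ℝ (gradDev f θstar s i j) (s.node i - θstar) := fun i => by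
    rw [nodeFlow, inner_sub_left, inner_neg_left, real_inner_smul_left,
      real_inner_self_eq_norm_sq, sum_inner]
  have h4 : ∀ k, inner ℝ (tokenFlow P θstar s k) (s.token k - θstar)
      = P.σt * ‖s.token k - θstar‖ ^ 2 := fun k => by
    rw [tokenFlow, real_inner_smul_left, real_inner_self_eq_norm_sq]
  have h5 : ∑ k, ∑ i, inner ℝ (edgeFlow (nodeFlow f P θstar s) (tokenFlow P θstar s) k i)
      (s.token k - θstar) = P.σt * ∑ k, ‖s.token k - θstar‖ ^ 2 := by
    rw [Finset.mul_sum]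
    refine Finset.sum_congr rfl fun k _ => ?_
    rw [← sum_inner, sum_edgeFlow_node hs, h4]
  have h6 : ∑ k, ∑ i, inner ℝ (edgeFlow (nodeFlow f P θstar s) (tokenFlow P θstar s) k i)
      (s.node i - θstar) = -(P.σt * ∑ i, ‖s.node i - θstar‖ ^ 2)
        - ∑ i, ∑ j, inner ℝ (gradDev f θstar s i j) (s.node i - θstar) := by
    rw [Finset.sum_comm, Finset.mul_sum, ← Finset.sum_neg_distrib, ← Finset.sum_sub_distrib]
    refine Finset.sum_congr rfl fun i _ => ?_
    rw [← sum_inner, sum_edgeFlow_token, h3]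
  simp only [h1, h2, Finset.sum_sub_distrib, Finset.sum_add_distrib, h5, h6]
  unfold dualGap virtualDiv sqError
  ring

/-- Expected decrease of the Lyapunov function when tokens land at uniformly random nodes. -/
theorem Admissible.uniform_step_le [NeZero n] [NeZero K] (h : Admissible K f L P θstar α μ η)
    (N : ℕ) {s : State n m K d} (hs : Balanced f P θstar s) :
    P.pcomm * (1 / K * ∑ k, ∑ i, 1 / n * lyapunov f P θstar α μ (TokenAlg.commUpdate P N s k i))
      + (1 - P.pcomm) * (1 / n * ∑ i, ∑ j,
          P.q i j * lyapunov f P θstar α μ (TokenAlg.compUpdate f P s i j))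
      ≤ (1 - 2 / 3 * (η * μ)) * lyapunov f P θstar α μ s := by
  have hn : (0 : ℝ) < n := by exact_mod_cast Nat.pos_of_ne_zero (NeZero.ne n)
  have hK : (0 : ℝ) < K := by exact_mod_cast Nat.pos_of_ne_zero (NeZero.ne K)
  have hp0 := P.pcomm_mem.1
  have hp1 := P.pcomm_mem.2
  set Λ := lyapunov f P θstar α μ s with hΛ
  set X : Fin K → Fin n → ℝ := fun k i =>
    inner ℝ (edgeFlow (nodeFlow f P θstar s) (tokenFlow P θstar s) k i) (s.token k - s.node i)
    with hX
  set Y : Fin n → Fin m → ℝ := fun i j => inner ℝ (gradDev f θstar s i j) (s.z i j - s.node i)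
    with hY
  have h1 : P.pcomm * (1 / K * ∑ k, ∑ i,
        1 / n * lyapunov f P θstar α μ (TokenAlg.commUpdate P N s k i))
      ≤ P.pcomm * Λ - η * μ * ∑ k, ∑ i, X k i := by
    calc _ ≤ P.pcomm * (1 / K * ∑ k : Fin K, ∑ i : Fin n,
          1 / n * (Λ - μ * (P.ρcomm * P.σt) * X k i)) := by
          gcongr with k _ i _
          exact h.lyapunov_commUpdate_le N s k i
      _ = P.pcomm * (1 / K * (K * (n * (1 / n * Λ))))
          - (P.pcomm * (P.ρcomm * P.σt)) * (μ / (n * K)) * ∑ k, ∑ i, X k i := by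
          simp only [mul_sub, Finset.sum_sub_distrib, Finset.sum_const, Finset.card_univ,
            Fintype.card_fin, nsmul_eq_mul, ← mul_assoc, ← Finset.mul_sum]
          field_simp
      _ = _ := by
          rw [h.ρcomm_eq]
          field_simp
  have h2 : (1 - P.pcomm) * (1 / n * ∑ i, ∑ j,
        P.q i j * lyapunov f P θstar α μ (TokenAlg.compUpdate f P s i j))
      ≤ (1 - P.pcomm) * Λ - η * μ * ∑ i, ∑ j, Y i j := by
    have hα := h.α_pos
    calc _ ≤ (1 - P.pcomm) * (1 / n * ∑ i, ∑ j,
          P.q i j * (Λ - μ / α * P.ρcomp i j * Y i j)) := by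
          have : 0 ≤ 1 - P.pcomm := by linarith
          gcongr with i _ j _
          · exact (P.q_mem i).1 j
          · exact h.lyapunov_compUpdate_le s i j
      _ = (1 - P.pcomm) * (1 / n * ∑ i, (∑ j, P.q i j) * Λ)
          - ∑ i, ∑ j, ((1 - P.pcomm) * (P.q i j * P.ρcomp i j)) * (μ / (n * α) * Y i j) := by
          simp only [mul_sub, Finset.sum_sub_distrib, Finset.mul_sum, Finset.sum_mul]
          congr 1
          refine Finset.sum_congr rfl fun i _ => Finset.sum_congr rfl fun j _ => ?_
          field_simp
      _ = _ := by
          simp only [h.ρcomp_eq, fun i => (P.q_mem i).2, one_mul, Finset.sum_const,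
            Finset.card_univ, Fintype.card_fin, nsmul_eq_mul, ← Finset.mul_sum]
          field_simp
  have h3 := hs.sum_inner_eq
  have h4 := h.lyapunov_le s
  -- The factor $\frac23$ makes the coefficient $\frac32$ of `virtualDiv` in `lyapunov_le` match the
  -- coefficient 1 in `h3`.
  have h5 : 2 / 3 * Λ ≤ ∑ k, ∑ i, X k i + ∑ i, ∑ j, Y i j := by
    rw [hX, hY, h3]
    have := mul_nonneg h.σt_pos.le (sqError_nonneg θstar s)
    linarith [h.dualGap_nonneg s]
  have h6 := mul_le_mul_of_nonneg_left h5 (mul_pos h.η_pos h.μ_pos).le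
  linarith

/-- Expected decrease of the Lyapunov function when tokens land at nearly uniformly random
nodes. -/
theorem Admissible.step_le [NeZero n] [NeZero K] (h : Admissible K f L P θstar α μ η)
    (N : ℕ) {s : State n m K d} (hs : Balanced f P θstar s) {Δ : ℝ} (hΔ0 : 0 ≤ Δ)
    (hΔ : 48 * (n * Δ) ≤ η * μ) (ω : Fin K → Fin n → ℝ) (hω : ∀ k i, ω k i ≤ 1 / n + Δ) :
    P.pcomm * (1 / K * ∑ k, ∑ i, ω k i * lyapunov f P θstar α μ (TokenAlg.commUpdate P N s k i))
      + (1 - P.pcomm) * (1 / n * ∑ i, ∑ j,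
          P.q i j * lyapunov f P θstar α μ (TokenAlg.compUpdate f P s i j))
      ≤ (1 - 1 / 2 * (η * μ)) * lyapunov f P θstar α μ s := by
  have hK : (0 : ℝ) < K := by exact_mod_cast Nat.pos_of_ne_zero (NeZero.ne K)
  have hp0 := P.pcomm_mem.1
  have hp1 := P.pcomm_mem.2
  have hΛ := h.lyapunov_nonneg s
  have h1 : P.pcomm * (1 / K * ∑ k, ∑ i,
        ω k i * lyapunov f P θstar α μ (TokenAlg.commUpdate P N s k i))
      ≤ P.pcomm * (1 / K * ∑ k, ∑ i,
          1 / n * lyapunov f P θstar α μ (TokenAlg.commUpdate P N s k i))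
        + n * Δ * (8 * lyapunov f P θstar α μ s) := by
    calc _ ≤ P.pcomm * (1 / K * ∑ k : Fin K, ∑ i : Fin n,
          (1 / n * lyapunov f P θstar α μ (TokenAlg.commUpdate P N s k i)
            + Δ * (8 * lyapunov f P θstar α μ s))) := by
          gcongr with k _ i _
          have h2 := mul_le_mul_of_nonneg_right (hω k i)
            (h.lyapunov_nonneg (TokenAlg.commUpdate P N s k i))
          have h3 := mul_le_mul_of_nonneg_left (h.lyapunov_commUpdate_le_mul N s k i) hΔ0
          linarith
      _ = P.pcomm * (1 / K * ∑ k, ∑ i,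
          1 / n * lyapunov f P θstar α μ (TokenAlg.commUpdate P N s k i))
          + P.pcomm * (n * Δ * (8 * lyapunov f P θstar α μ s)) := by
          simp only [Finset.sum_add_distrib, Finset.sum_const, Finset.card_univ,
            Fintype.card_fin, nsmul_eq_mul]
          field_simp
      _ ≤ _ := by
          exact add_le_add le_rfl (mul_le_of_le_one_left
            (mul_nonneg (mul_nonneg (Nat.cast_nonneg n) hΔ0) (by linarith)) hp1)
  have h2 := h.uniform_step_le N hs
  -- The excess $8n\Delta$ is at most $\frac16\eta\mu$, and $\frac23-\frac16=\frac12$.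
  have h3 := mul_le_mul_of_nonneg_right hΔ hΛ
  linarith

end OneStep

/-! ### Expected values -/

section Expect
variable {α β : Type}

theorem expect_pure (a : α) (φ : α → ℝ≥0∞) : expect (PMF.pure a) φ = φ a := by
  unfold expect
  rw [tsum_eq_single a (fun b hb => by rw [PMF.pure_apply_of_ne _ _ hb, zero_mul]),
    PMF.pure_apply_self, one_mul]

theorem expect_bind (p : PMF α) (g : α → PMF β) (φ : β → ℝ≥0∞) :
    expect (p.bind g) φ = expect p fun a => expect (g a) φ := by
  unfold expect
  simp only [PMF.bind_apply, ← ENNReal.tsum_mul_right, ← ENNReal.tsum_mul_left]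
  rw [ENNReal.tsum_comm]
  simp only [mul_assoc]

theorem expect_map (p : PMF α) (g : α → β) (φ : β → ℝ≥0∞) :
    expect (p.map g) φ = expect p fun a => φ (g a) := by
  rw [← PMF.bind_pure_comp, expect_bind]
  simp only [Function.comp, expect_pure]

theorem expect_fintype [Fintype α] (p : PMF α) (φ : α → ℝ≥0∞) :
    expect p φ = ∑ a, p a * φ a :=
  tsum_fintype _

theorem expect_mono (p : PMF α) {φ ψ : α → ℝ≥0∞} (h : ∀ a, φ a ≤ ψ a) :
    expect p φ ≤ expect p ψ :=
  ENNReal.tsum_le_tsum fun a => mul_le_mul_right (h a) _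

theorem expect_const (p : PMF α) (c : ℝ≥0∞) : expect p (fun _ => c) = c := by
  unfold expect
  rw [ENNReal.tsum_mul_right, p.tsum_coe, one_mul]

theorem expect_add (p : PMF α) (φ ψ : α → ℝ≥0∞) :
    expect p (fun a => φ a + ψ a) = expect p φ + expect p ψ := by
  simp only [expect, mul_add, ENNReal.tsum_add]

theorem expect_const_mul (p : PMF α) (c : ℝ≥0∞) (φ : α → ℝ≥0∞) :
    expect p (fun a => c * φ a) = c * expect p φ := by
  simp only [expect, mul_left_comm _ c, ENNReal.tsum_mul_left]

theorem expect_sum {ι : Type} (I : Finset ι) (p : PMF α) (φ : ι → α → ℝ≥0∞) :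
    expect p (fun a => ∑ i ∈ I, φ i a) = ∑ i ∈ I, expect p (φ i) := by
  simp only [expect, Finset.mul_sum]
  exact Summable.tsum_finsetSum fun _ _ => ENNReal.summable

theorem expect_ofWeights [Fintype α] (w : α → ℝ) (hw : w ∈ stdSimplex ℝ α) (φ : α → ℝ≥0∞) :
    expect (ofWeights w hw) φ = ∑ a, ENNReal.ofReal (w a) * φ a := by
  rw [expect_fintype]
  rfl

theorem expect_coin (p : ℝ) (hp : p ∈ Set.Icc (0 : ℝ) 1) (φ : Bool → ℝ≥0∞) :
    expect (coin p hp) φ = ENNReal.ofReal p * φ true + ENNReal.ofReal (1 - p) * φ false :=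
  (expect_ofWeights _ _ φ).trans (by simp)

theorem expect_uniform_fin (K : ℕ) [NeZero K] (φ : Fin K → ℝ≥0∞) :
    expect (PMF.uniformOfFintype (Fin K)) φ = ENNReal.ofReal (1 / K) * ∑ k, φ k := by
  have hK : (0 : ℝ) < K := by exact_mod_cast Nat.pos_of_ne_zero (NeZero.ne K)
  simp only [expect_fintype, PMF.uniformOfFintype_apply, Fintype.card_fin, ← Finset.mul_sum]
  rw [one_div, ENNReal.ofReal_inv_of_pos hK, ENNReal.ofReal_natCast]

end Expect

/-! ### The walk of a token -/

section Walk
variable {n : ℕ} {W : Matrix (Fin n) (Fin n) ℝ}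

theorem pow_nonneg_of_mem_colStochastic (hW : W ∈ Matrix.colStochastic ℝ (Fin n)) (N : ℕ)
    (i j : Fin n) : 0 ≤ (W ^ N) i j :=
  (Matrix.mem_colStochastic_iff_sum.1 (pow_mem hW N)).1 i j

theorem walk_apply (hW : W ∈ Matrix.colStochastic ℝ (Fin n)) (N : ℕ) (j i : Fin n) :
    walk W hW N j i = ENNReal.ofReal ((W ^ N) i j) := by
  induction N generalizing j with
  | zero =>
    rw [walk, PMF.pure_apply, pow_zero, Matrix.one_apply]
    split_ifs <;> simp
  | succ N ih =>
    rw [walk, PMF.bind_apply, tsum_fintype, pow_succ, Matrix.mul_apply,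
      ENNReal.ofReal_sum_of_nonneg fun l _ => mul_nonneg
        (pow_nonneg_of_mem_colStochastic hW N i l)
        ((Matrix.mem_colStochastic_iff_sum.1 hW).1 l j)]
    refine Finset.sum_congr rfl fun l _ => ?_
    rw [ih, mul_comm, ENNReal.ofReal_mul (pow_nonneg_of_mem_colStochastic hW N i l)]
    rfl

theorem MixesTo.abs_sub_le {π : Fin n → ℝ} {C γ : ℝ} (h : MixesTo W π C γ) (N : ℕ)
    (i j : Fin n) : |(W ^ N) i j - π i| ≤ C * (1 - γ) ^ N := by
  have h1 := h (Pi.single j 1) (single_mem_stdSimplex ℝ j) N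
  rw [Matrix.mulVec_single_one] at h1
  exact (norm_le_pi_norm _ i).trans h1

end Walk

/-! ### Expected values along the iterations -/

section Law
variable {n m K d : ℕ} [NeZero n] [NeZero K] {f : Fin n → Fin m → Vec d → ℝ} {P : Params n m}
  {W : Matrix (Fin n) (Fin n) ℝ} {hW : W ∈ Matrix.colStochastic ℝ (Fin n)} {N : ℕ}

theorem expect_step (s : State n m K d) (φ : State n m K d → ℝ≥0∞) :
    expect (step f P W hW N s) φ
      = ENNReal.ofReal P.pcomm * (ENNReal.ofReal (1 / K) * ∑ k, ∑ i,
          ENNReal.ofReal ((W ^ N) i (s.pos k)) * φ (commUpdate P N s k i))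
        + ENNReal.ofReal (1 - P.pcomm) * (ENNReal.ofReal (1 / n) * ∑ i, ∑ j,
          ENNReal.ofReal (P.q i j) * φ (compUpdate f P s i j)) := by
  rw [step, expect_bind, expect_coin]
  simp only [if_true, Bool.false_eq_true, if_false, expect_bind, expect_map,
    expect_uniform_fin, expect_ofWeights]
  simp only [expect_fintype, walk_apply]

theorem expect_step_ofReal (s : State n m K d) {g : State n m K d → ℝ} (hg : ∀ s, 0 ≤ g s) :
    expect (step f P W hW N s) (fun s => ENNReal.ofReal (g s))
      = ENNReal.ofReal (P.pcomm * (1 / K * ∑ k, ∑ i,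
          (W ^ N) i (s.pos k) * g (commUpdate P N s k i))
        + (1 - P.pcomm) * (1 / n * ∑ i, ∑ j, P.q i j * g (compUpdate f P s i j))) := by
  have hp0 := P.pcomm_mem.1
  have hp1 : 0 ≤ 1 - P.pcomm := by linarith [P.pcomm_mem.2]
  have h1 : ∀ k i, 0 ≤ (W ^ N) i (s.pos k) * g (commUpdate P N s k i) := fun k i =>
    mul_nonneg (pow_nonneg_of_mem_colStochastic hW N _ _) (hg _)
  have h2 : ∀ i j, 0 ≤ P.q i j * g (compUpdate f P s i j) := fun i j =>
    mul_nonneg ((P.q_mem i).1 j) (hg _)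
  have h3 : ∀ k, 0 ≤ ∑ i, (W ^ N) i (s.pos k) * g (commUpdate P N s k i) := fun k =>
    Finset.sum_nonneg fun i _ => h1 k i
  have h4 : ∀ i, 0 ≤ ∑ j, P.q i j * g (compUpdate f P s i j) := fun i =>
    Finset.sum_nonneg fun j _ => h2 i j
  rw [expect_step, ENNReal.ofReal_add
      (mul_nonneg hp0 (mul_nonneg (by positivity) (Finset.sum_nonneg fun k _ => h3 k)))
      (mul_nonneg hp1 (mul_nonneg (by positivity) (Finset.sum_nonneg fun i _ => h4 i))),
    ENNReal.ofReal_mul hp0, ENNReal.ofReal_mul hp1, ENNReal.ofReal_mul (by positivity),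
    ENNReal.ofReal_mul (by positivity), ENNReal.ofReal_sum_of_nonneg fun k _ => h3 k,
    ENNReal.ofReal_sum_of_nonneg fun i _ => h4 i]
  simp only [ENNReal.ofReal_sum_of_nonneg fun i _ => h1 _ i,
    ENNReal.ofReal_sum_of_nonneg fun j _ => h2 _ j,
    ENNReal.ofReal_mul (pow_nonneg_of_mem_colStochastic hW N _ _),
    ENNReal.ofReal_mul ((P.q_mem _).1 _)]

theorem expect_law_le_pow (s₀ : State n m K d) {φ : State n m K d → ℝ≥0∞} {r : ℝ≥0∞}
    (h : ∀ s, expect (step f P W hW N s) φ ≤ r * φ s) (t : ℕ) :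
    expect (law f P W hW N s₀ t) φ ≤ r ^ t * φ s₀ := by
  induction t with
  | zero => rw [law, expect_pure, pow_zero, one_mul]
  | succ t ih =>
    rw [law, expect_bind]
    refine (expect_mono _ h).trans ?_
    rw [expect_const_mul, pow_succ', mul_assoc]
    gcongr

theorem expect_law_le_add (s₀ : State n m K d) {φ : State n m K d → ℝ≥0∞} {c : ℝ≥0∞}
    (h : ∀ s, expect (step f P W hW N s) φ ≤ φ s + c) (t : ℕ) :
    expect (law f P W hW N s₀ t) φ ≤ φ s₀ + t * c := by
  induction t with
  | zero => rw [law, expect_pure]; simp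
  | succ t ih =>
    rw [law, expect_bind]
    refine (expect_mono _ h).trans ?_
    rw [expect_add, expect_const, Nat.cast_succ, add_mul, one_mul, ← add_assoc]
    gcongr

theorem expect_step_jumps (s : State n m K d) (k : Fin K) :
    expect (step f P W hW N s) (fun s => (s.jumps k : ℝ≥0∞))
      ≤ s.jumps k + ENNReal.ofReal (P.pcomm * (N / K)) := by
  have hK : (0 : ℝ) < K := by exact_mod_cast Nat.pos_of_ne_zero (NeZero.ne K)
  have hn : (0 : ℝ) < n := by exact_mod_cast Nat.pos_of_ne_zero (NeZero.ne n)
  have hc := fun j => (Matrix.mem_colStochastic_iff_sum.1 (pow_mem hW N)).2 j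
  have h := expect_step_ofReal (f := f) (P := P) (hW := hW) (N := N) s
    (g := fun s : State n m K d => (s.jumps k : ℝ)) (fun s => Nat.cast_nonneg _)
  simp only [ENNReal.ofReal_natCast] at h
  rw [h, ← ENNReal.ofReal_natCast, ← ENNReal.ofReal_add (Nat.cast_nonneg _)
    (mul_nonneg P.pcomm_mem.1 (by positivity))]
  refine ENNReal.ofReal_le_ofReal (le_of_eq ?_)
  have h1 : ∀ k' i, ((commUpdate P N s k' i).jumps k : ℝ)
      = s.jumps k + if k = k' then (N : ℝ) else 0 := by
    intro k' i
    rcases eq_or_ne k k' with rfl | hk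
    · simp [commUpdate]
    · simp [commUpdate, hk]
  have h2 : ∀ i j, ((compUpdate f P s i j).jumps k : ℝ) = s.jumps k := fun i j => rfl
  simp only [h1, h2, ← Finset.sum_mul, hc, (P.q_mem _).2, one_mul, Finset.sum_add_distrib,
    Finset.sum_ite_eq, Finset.mem_univ, if_true, Finset.sum_const, Finset.card_univ,
    Fintype.card_fin, nsmul_eq_mul]
  field_simp
  ring

theorem expect_step_grads (s : State n m K d) (i : Fin n) :
    expect (step f P W hW N s) (fun s => (s.grads i : ℝ≥0∞))
      ≤ s.grads i + ENNReal.ofReal ((1 - P.pcomm) / n) := by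
  have hK : (0 : ℝ) < K := by exact_mod_cast Nat.pos_of_ne_zero (NeZero.ne K)
  have hn : (0 : ℝ) < n := by exact_mod_cast Nat.pos_of_ne_zero (NeZero.ne n)
  have hc := fun j => (Matrix.mem_colStochastic_iff_sum.1 (pow_mem hW N)).2 j
  have h := expect_step_ofReal (f := f) (P := P) (hW := hW) (N := N) s
    (g := fun s : State n m K d => (s.grads i : ℝ)) (fun s => Nat.cast_nonneg _)
  simp only [ENNReal.ofReal_natCast] at h
  rw [h, ← ENNReal.ofReal_natCast, ← ENNReal.ofReal_add (Nat.cast_nonneg _)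
    (div_nonneg (by linarith [P.pcomm_mem.2]) hn.le)]
  refine ENNReal.ofReal_le_ofReal (le_of_eq ?_)
  have h1 : ∀ k' i', ((commUpdate P N s k' i').grads i : ℝ) = s.grads i := fun _ _ => rfl
  have h2 : ∀ i' j, ((compUpdate f P s i' j).grads i : ℝ)
      = s.grads i + if i = i' then (1 : ℝ) else 0 := by
    intro i' j
    rcases eq_or_ne i i' with rfl | hi
    · simp [compUpdate]
    · simp [compUpdate, hi]
  simp only [h1, h2, ← Finset.sum_mul, hc, (P.q_mem _).2, one_mul, Finset.sum_add_distrib,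
    Finset.sum_ite_eq, Finset.mem_univ, if_true, Finset.sum_const, Finset.card_univ,
    Fintype.card_fin, nsmul_eq_mul]
  field_simp
  ring

theorem expect_law_jumps_le (z₀ : Fin n → Fin m → Vec d) (pos₀ : Fin K → Fin n) (T : ℕ)
    (k : Fin K) :
    expect (law f P W hW N (initState f P z₀ pos₀) T) (fun s => (s.jumps k : ℝ≥0∞))
      ≤ ENNReal.ofReal (T * (P.pcomm * (N / K))) := by
  refine (expect_law_le_add _ (fun s => expect_step_jumps s k) T).trans (le_of_eq ?_)
  rw [ENNReal.ofReal_mul (Nat.cast_nonneg T), ENNReal.ofReal_natCast]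
  simp [initState]

theorem expect_law_grads_le (z₀ : Fin n → Fin m → Vec d) (pos₀ : Fin K → Fin n) (T : ℕ)
    (i : Fin n) :
    expect (law f P W hW N (initState f P z₀ pos₀) T) (fun s => (s.grads i : ℝ≥0∞))
      ≤ ENNReal.ofReal (T * ((1 - P.pcomm) / n)) := by
  refine (expect_law_le_add _ (fun s => expect_step_grads s i) T).trans (le_of_eq ?_)
  rw [ENNReal.ofReal_mul (Nat.cast_nonneg T), ENNReal.ofReal_natCast]
  simp [initState]

theorem expect_law_sum_jumps_le (z₀ : Fin n → Fin m → Vec d) (pos₀ : Fin K → Fin n) (T : ℕ) :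
    expect (law f P W hW N (initState f P z₀ pos₀) T)
      (fun s => ((∑ k, s.jumps k : ℕ) : ℝ≥0∞)) ≤ ENNReal.ofReal (T * (P.pcomm * N)) := by
  have hK : (0 : ℝ) < K := by exact_mod_cast Nat.pos_of_ne_zero (NeZero.ne K)
  simp only [Nat.cast_sum]
  rw [expect_sum]
  refine (Finset.sum_le_sum fun k _ => expect_law_jumps_le z₀ pos₀ T k).trans (le_of_eq ?_)
  have hp := P.pcomm_mem.1
  rw [Finset.sum_const, Finset.card_univ, Fintype.card_fin, nsmul_eq_mul,
    ← ENNReal.ofReal_natCast K, ← ENNReal.ofReal_mul (Nat.cast_nonneg _)]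
  congr 1
  field_simp

end Law

/-! ### Logarithmic factors -/

theorem one_le_logP (x : ℝ) : 1 ≤ logP x := le_max_left _ _

/-- A decimal upper bound for $e^{-1}$, sharp enough that $48\cdot0.37^4\le1$ and
$5\cdot0.37^2\le1$; these two inequalities absorb the constants later. -/
theorem exp_neg_logP_le (x : ℝ) : Real.exp (-logP x) ≤ 0.37 := by
  refine (Real.exp_le_exp.2 (neg_le_neg (one_le_logP x))).trans ?_
  rw [Real.exp_neg]
  exact (inv_le_comm₀ (Real.exp_pos 1) (by norm_num)).2
    (le_trans (by norm_num) Real.exp_one_gt_d9.le)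

theorem mul_exp_neg_logP_le {x : ℝ} (hx : 0 ≤ x) : x * Real.exp (-logP x) ≤ 1 := by
  rcases hx.eq_or_lt with rfl | hx
  · simp
  · calc x * Real.exp (-logP x) ≤ x * Real.exp (-Real.log x) := by
          gcongr
          exact le_max_right _ _
      _ = 1 := by rw [Real.exp_neg, Real.exp_log hx, mul_inv_cancel₀ hx.ne']

/-! ### Near-uniformity of the landing node -/

section Mixing
variable {n : ℕ} [NeZero n] {W : Matrix (Fin n) (Fin n) ℝ} {C γ : ℝ}

/-- At time 1 the mixing bound must be nonnegative. -/
theorem MixesTo.γ_le_one {π : Fin n → ℝ} (h : MixesTo W π C γ) (hC : 0 < C) : γ ≤ 1 := by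
  have h1 := (abs_nonneg _).trans (h.abs_sub_le 1 0 0)
  rw [pow_one] at h1
  linarith [nonneg_of_mul_nonneg_right h1 hC]

/-- At time 0 a point mass is at distance $1-1/n\ge\frac12$ from uniform. -/
theorem MixesTo.half_le (h : MixesTo W (fun _ => 1 / (n : ℝ)) C γ) (hn : 2 ≤ n) :
    1 / 2 ≤ C := by
  have h1 := h.abs_sub_le 0 0 0
  have h2 : 1 / (n : ℝ) ≤ 1 / 2 := one_div_le_one_div_of_le two_pos (by exact_mod_cast hn)
  rw [pow_zero, pow_zero, mul_one, Matrix.one_apply_eq] at h1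
  linarith [(le_abs_self _).trans h1]

/-- After sufficiently many jumps, the law of the position of a token is close to uniform. -/
theorem MixesTo.error_le (h : MixesTo W (fun _ => 1 / (n : ℝ)) C γ) (hC : 0 < C) (hγ : 0 < γ)
    {x : ℝ} (hx : 0 < x) (hxn : 2 * n * x ≤ 1) {N : ℕ} (hN : 6 * γ⁻¹ * logP (C / x) ≤ N) :
    48 * (n * (C * (1 - γ) ^ N)) ≤ x := by
  have hn0 : (0 : ℝ) < n := by exact_mod_cast Nat.pos_of_ne_zero (NeZero.ne n)
  set u := Real.exp (-logP (C / x)) with hu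
  have hu0 : 0 < u := Real.exp_pos _
  have hu1 : u ≤ 0.37 := exp_neg_logP_le _
  have hCu : C * u ≤ x := by
    have h1 := mul_exp_neg_logP_le (div_pos hC hx).le
    rw [div_mul_eq_mul_div, div_le_one hx] at h1
    exact h1
  -- For $n\ge2$, $C\ge\frac12$ gives $u\le2x\le1/n$.
  have hnu : n * u ≤ 1 := by
    rcases Nat.lt_or_ge n 2 with hn | hn
    · have : (n : ℝ) ≤ 1 := by exact_mod_cast Nat.lt_succ_iff.1 hn
      nlinarith
    · nlinarith [h.half_le hn]
  have hpow : (1 - γ) ^ N ≤ u ^ 6 := by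
    calc (1 - γ) ^ N ≤ Real.exp (-γ) ^ N :=
          pow_le_pow_left₀ (by linarith [h.γ_le_one hC]) (Real.one_sub_le_exp_neg γ) N
      _ = Real.exp (-(γ * N)) := by rw [← Real.exp_nat_mul]; ring_nf
      _ ≤ Real.exp (6 * -logP (C / x)) := by
          refine Real.exp_le_exp.2 ?_
          have := mul_le_mul_of_nonneg_left hN hγ.le
          rw [← mul_assoc, mul_left_comm, mul_inv_cancel₀ hγ.ne'] at this
          linarith
      _ = u ^ 6 := by rw [hu, ← Real.exp_nat_mul]; norm_num
  have hu4 : u ^ 4 ≤ 0.37 ^ 4 := pow_le_pow_left₀ hu0.le hu1 4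
  -- Of the six factors $u$, one turns $C$ into $x$, one absorbs $n$ and four absorb 48.
  calc 48 * (n * (C * (1 - γ) ^ N)) ≤ 48 * (n * (C * u ^ 6)) := by gcongr
    _ = 48 * u ^ 4 * ((n * u) * (C * u)) := by ring
    _ ≤ 1 * (1 * x) := by
        gcongr
        linarith
    _ = x := by ring

end Mixing

/-! ### Optimality -/

/-- Differentiating the objective at the minimizer along its own gradient `G` gives $\|G\|^2=0$. -/
theorem sum_gradient_eq_zero {n m d : ℕ} {f : Fin n → Fin m → Vec d → ℝ} {σ : ℝ}
    (hf : ∀ i j, Differentiable ℝ (f i j)) {θstar : Vec d}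
    (h : IsMinOn (objective f σ) Set.univ θstar) :
    ((n : ℝ) * σ) • θstar + ∑ i, ∑ j, ∇ (f i j) θstar = 0 := by
  set G := ((n : ℝ) * σ) • θstar + ∑ i, ∑ j, ∇ (f i j) θstar with hG
  have hd : HasDerivAt (fun t : ℝ => objective f σ (θstar + t • G))
      (∑ i : Fin n, (∑ j, inner ℝ (∇ (f i j) (θstar + (0 : ℝ) • G)) G
        + σ / 2 * (2 * inner ℝ (θstar + (0 : ℝ) • G) G))) 0 := by
    have h1 : HasDerivAt (fun t : ℝ => θstar + t • G) G 0 := by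
      simpa using ((hasDerivAt_id (0 : ℝ)).smul_const G).const_add θstar
    unfold objective
    exact HasDerivAt.fun_sum fun i _ => (HasDerivAt.fun_sum fun j _ =>
      hasDerivAt_comp_segment (hf i j) θstar G 0).add (h1.norm_sq.const_mul _)
  have hmin : IsLocalMin (fun t : ℝ => objective f σ (θstar + t • G)) 0 :=
    Filter.Eventually.of_forall fun t => by
      simpa using h (Set.mem_univ (θstar + t • G))
  have h0 := hmin.hasDerivAt_eq_zero hd
  simp only [zero_smul, add_zero] at h0
  have h2 : inner ℝ G G = (0 : ℝ) := by
    rw [← h0]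
    conv_lhs => rw [hG]
    rw [← hG, inner_add_left, real_inner_smul_left, sum_inner, Finset.sum_add_distrib]
    simp only [sum_inner, Finset.sum_const, Finset.card_univ, Fintype.card_fin, nsmul_eq_mul]
    ring
  exact inner_self_eq_zero.1 h2

theorem add_mul_sigmaT (n K : ℕ) [NeZero n] (σ : ℝ) :
    ((n : ℝ) + K) * sigmaT n K σ = n * σ := by
  have hn : (0 : ℝ) < n := by exact_mod_cast Nat.pos_of_ne_zero (NeZero.ne n)
  have : (n : ℝ) + K ≠ 0 := by positivity
  unfold sigmaT
  field_simp

/-! ### Convergence in expectation -/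

section Convergence
variable {n m K d : ℕ} {f : Fin n → Fin m → Vec d → ℝ} {L : Fin n → Fin m → ℝ} {P : Params n m}
  {θstar : Vec d} {α μ η : ℝ}

/-- The initial node values cancel the gradients at `z₀`, so balance reduces to the optimality
condition. -/
theorem Admissible.balanced_initState (h : Admissible K f L P θstar α μ η)
    (z₀ : Fin n → Fin m → Vec d) (pos₀ : Fin K → Fin n) :
    Balanced f P θstar (initState f P z₀ pos₀) := by
  have h1 : ∀ i, nodeFlow f P θstar (initState f P z₀ pos₀) i
      = P.σt • θstar + ∑ j, ∇ (f i j) θstar := fun i => by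
    simp only [nodeFlow, initState, gradDev, Finset.sum_sub_distrib, smul_sub, smul_neg, smul_smul]
    rw [mul_one_div_cancel h.σt_pos.ne']
    module
  have h2 : ∀ k, tokenFlow P θstar (initState f P z₀ pos₀) k = -(P.σt • θstar) := fun k => by
    simp [tokenFlow, initState]
  have h3 := h.optimal
  rw [add_smul] at h3
  simp only [Balanced, h1, h2, Finset.sum_add_distrib, Finset.sum_const, Finset.card_univ,
    Fintype.card_fin, ← Nat.cast_smul_eq_nsmul ℝ]
  rw [smul_neg, ← sub_eq_zero, ← h3]
  abel

/-- Smoothness bounds both orders of the Bregman divergence by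
$\frac12\tilde\sigma\kappa\|z-\theta_\star\|^2$; their coefficients $\frac32$ and 1 in the Lyapunov
bound give $\frac54$. -/
theorem Admissible.lyapunov_le_mul_fullSqError [NeZero n] [NeZero K]
    (h : Admissible K f L P θstar α μ η) (s : State n m K d) {κ : ℝ} (hκ1 : 1 ≤ κ)
    (hκ : ∀ i j, L i j / P.σt ≤ κ) :
    lyapunov f P θstar α μ s ≤ 5 / 4 * P.σt * κ * fullSqError θstar s := by
  have hσ := h.σt_pos
  have h1 : ∀ i j, L i j ≤ P.σt * κ := fun i j => by
    have := (div_le_iff₀ hσ).1 (hκ i j)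
    linarith
  have h2 : virtualDiv f θstar s ≤ P.σt * κ / 2 * ∑ i, ∑ j, ‖s.z i j - θstar‖ ^ 2 := by
    simp only [virtualDiv, Finset.mul_sum]
    refine Finset.sum_le_sum fun i _ => Finset.sum_le_sum fun j _ =>
      ((h.smooth i j).bregman_le _ _).trans ?_
    gcongr
    exact h1 i j
  have h3 : ∑ i, ∑ j, bregman (f i j) θstar (s.z i j)
      ≤ P.σt * κ / 2 * ∑ i, ∑ j, ‖s.z i j - θstar‖ ^ 2 := by
    simp only [Finset.mul_sum]
    refine Finset.sum_le_sum fun i _ => Finset.sum_le_sum fun j _ =>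
      ((h.smooth i j).bregman_le _ _).trans ?_
    rw [norm_sub_rev]
    gcongr
    exact h1 i j
  have h4 := h.lyapunov_le s
  have h5 : P.σt * sqError θstar s ≤ P.σt * κ * sqError θstar s := by
    have := sqError_nonneg θstar s
    gcongr
    exact le_mul_of_one_le_right hσ.le hκ1
  have h6 := mul_nonneg hσ.le (sqError_nonneg θstar s)
  unfold dualGap at h4
  unfold fullSqError
  linarith

theorem Admissible.expect_sqError_le [NeZero n] [NeZero K] (h : Admissible K f L P θstar α μ η)
    {W : Matrix (Fin n) (Fin n) ℝ} {hW : W ∈ Matrix.colStochastic ℝ (Fin n)} {N : ℕ} {Δ : ℝ}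
    (hΔ0 : 0 ≤ Δ) (hΔ : 48 * (n * Δ) ≤ η * μ) (hWN : ∀ i j, (W ^ N) i j ≤ 1 / n + Δ)
    (hημ : η * μ ≤ 1) {s₀ : State n m K d} (hs₀ : Balanced f P θstar s₀) (t : ℕ) :
    expect (law f P W hW N s₀ t) (fun s => ENNReal.ofReal (sqError θstar s))
      ≤ ENNReal.ofReal
          (2 / P.σt * ((1 - 1 / 2 * (η * μ)) ^ t * lyapunov f P θstar α μ s₀)) := by
  classical
  have hσ := h.σt_pos
  have hr : 0 < 1 - 1 / 2 * (η * μ) := by linarith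
  have hr' : ENNReal.ofReal (1 - 1 / 2 * (η * μ)) ≠ 0 := (ENNReal.ofReal_pos.2 hr).ne'
  -- The contraction holds on balanced states only. The value `⊤` elsewhere makes it true for all
  -- states, so the support of the law need not be discussed.
  set φ : State n m K d → ℝ≥0∞ := fun s =>
    if Balanced f P θstar s then ENNReal.ofReal (lyapunov f P θstar α μ s) else ⊤ with hφ
  have hstep : ∀ s, expect (step f P W hW N s) φ
      ≤ ENNReal.ofReal (1 - 1 / 2 * (η * μ)) * φ s := by
    intro s
    by_cases hs : Balanced f P θstar s
    · have h1 : expect (step f P W hW N s) φ = expect (step f P W hW N s)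
          (fun s => ENNReal.ofReal (lyapunov f P θstar α μ s)) := by
        rw [expect_step, expect_step]
        simp only [hφ, hs.commUpdate N, hs.compUpdate hσ.ne', if_true]
      rw [h1, expect_step_ofReal s h.lyapunov_nonneg]
      simp only [hφ, hs, if_true]
      rw [← ENNReal.ofReal_mul hr.le]
      exact ENNReal.ofReal_le_ofReal
        (h.step_le N hs hΔ0 hΔ (fun k i => (W ^ N) i (s.pos k)) fun k i => hWN _ _)
    · simp only [hφ, hs, if_false]
      rw [ENNReal.mul_top hr']
      exact le_top
  have h2 : ∀ s, ENNReal.ofReal (sqError θstar s) ≤ ENNReal.ofReal (2 / P.σt) * φ s := by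
    intro s
    by_cases hs : Balanced f P θstar s
    · simp only [hφ, hs, if_true]
      rw [← ENNReal.ofReal_mul (by positivity)]
      exact ENNReal.ofReal_le_ofReal (h.sqError_le s)
    · simp only [hφ, hs, if_false]
      rw [ENNReal.mul_top (ENNReal.ofReal_pos.2 (by positivity)).ne']
      exact le_top
  refine (expect_mono _ h2).trans ?_
  rw [expect_const_mul, ENNReal.ofReal_mul (by positivity), ENNReal.ofReal_mul (by positivity),
    ENNReal.ofReal_pow hr.le]
  gcongr
  refine (expect_law_le_pow s₀ hstep t).trans (le_of_eq ?_)
  simp only [hφ, hs₀, if_true]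

/-- Number of iterations and of token jumps needed by an algorithm with admissible parameters. -/
theorem Admissible.complexity [NeZero n] [NeZero K] (h : Admissible K f L P θstar α μ η)
    {W : Matrix (Fin n) (Fin n) ℝ} (hW : W ∈ Matrix.colStochastic ℝ (Fin n)) {C γ : ℝ}
    (hC : 0 < C) (hγ : 0 < γ) (hmix : MixesTo W (fun _ => 1 / (n : ℝ)) C γ) {N : ℕ}
    (hN : 6 * γ⁻¹ * logP (C / (η * μ)) ≤ N) {A : ℝ} (hA : N ≤ A * γ⁻¹ * logP (C / (η * μ)))
    (hA0 : 0 ≤ A) (hn : 2 * n * (η * μ) ≤ 1) {κ : ℝ} (hκ1 : 1 ≤ κ)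
    (hκ : ∀ i j, L i j / P.σt ≤ 2 * κ) (hcomm : P.pcomm ≤ 8 * (n * κ) * (η * μ))
    (z₀ : Fin n → Fin m → Vec d) (pos₀ : Fin K → Fin n) {ε : ℝ} (hε : 0 < ε) {c : ℝ}
    (hc : 56 * A ≤ c) :
    ∃ T : ℕ,
      T * (η * μ) ≤ 7 * logP (κ ^ 2 * fullSqError θstar (initState f P z₀ pos₀) / ε) ∧
      (∀ t : ℕ, T ≤ t →
        expect (law f P W hW N (initState f P z₀ pos₀) t)
          (fun s => ENNReal.ofReal (sqError θstar s)) ≤ ENNReal.ofReal ε) ∧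
      (∀ k : Fin K, expect (law f P W hW N (initState f P z₀ pos₀) T)
          (fun s => (s.jumps k : ℝ≥0∞))
        ≤ ENNReal.ofReal (c * (n * κ / (K * γ)) * logP (C / (η * μ))
          * logP (κ ^ 2 * fullSqError θstar (initState f P z₀ pos₀) / ε))) ∧
      expect (law f P W hW N (initState f P z₀ pos₀) T)
          (fun s => ((∑ k, s.jumps k : ℕ) : ℝ≥0∞))
        ≤ ENNReal.ofReal (c * (n * κ / γ) * logP (C / (η * μ))
          * logP (κ ^ 2 * fullSqError θstar (initState f P z₀ pos₀) / ε)) := by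
  have hn0 : (1 : ℝ) ≤ n := by exact_mod_cast Nat.one_le_iff_ne_zero.2 (NeZero.ne n)
  have hK : (0 : ℝ) < K := by exact_mod_cast Nat.pos_of_ne_zero (NeZero.ne K)
  have hx : 0 < η * μ := mul_pos h.η_pos h.μ_pos
  set s₀ := initState f P z₀ pos₀ with hs₀
  set E := fullSqError θstar s₀ with hE
  have hE0 : 0 ≤ E := by
    have := sqError_nonneg θstar s₀
    rw [hE, fullSqError]
    positivity
  set ℓ := logP (κ ^ 2 * E / ε) with hℓ
  set J := logP (C / (η * μ)) with hJ
  set x := η * μ with hxdef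
  have hx1 : x ≤ 1 := by nlinarith
  have hℓ1 : 1 ≤ ℓ := one_le_logP _
  have hJ1 : 1 ≤ J := one_le_logP _
  have hT : (⌈6 / x * ℓ⌉₊ : ℝ) * x ≤ 7 * ℓ := by
    have h1 := Nat.ceil_lt_add_one (a := 6 / x * ℓ) (by positivity)
    have h2 := mul_le_mul_of_nonneg_right h1.le hx.le
    have h3 : (6 / x * ℓ + 1) * x = 6 * ℓ + x := by field_simp
    linarith
  have hjumps : (⌈6 / x * ℓ⌉₊ : ℝ) * (P.pcomm * N) ≤ c * (n * κ / γ) * J * ℓ := by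
    have hp := P.pcomm_mem.1
    calc (⌈6 / x * ℓ⌉₊ : ℝ) * (P.pcomm * N)
        ≤ (⌈6 / x * ℓ⌉₊ : ℝ) * ((8 * (n * κ) * x) * (A * γ⁻¹ * J)) := by gcongr
      _ = ((⌈6 / x * ℓ⌉₊ : ℝ) * x) * ((8 * (n * κ)) * (A * γ⁻¹ * J)) := by ring
      _ ≤ (7 * ℓ) * ((8 * (n * κ)) * (A * γ⁻¹ * J)) := by gcongr
      _ = (56 * A) * (n * κ / γ) * J * ℓ := by ring
      _ ≤ _ := by gcongr
  -- At rate $1-x/2$, this many iterations give a factor $e^{-3\ell}$.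
  refine ⟨⌈6 / x * ℓ⌉₊, hT, fun t ht => ?_, fun k => ?_, ?_⟩
  · have hγ1 := hmix.γ_le_one hC
    have hΔ0 : 0 ≤ C * (1 - γ) ^ N := mul_nonneg hC.le (pow_nonneg (by linarith) N)
    refine (h.expect_sqError_le hΔ0 (hmix.error_le hC hγ hx hn hN) (fun i j => ?_) hx1
      (h.balanced_initState z₀ pos₀) t).trans (ENNReal.ofReal_le_ofReal ?_)
    · have := (le_abs_self _).trans (hmix.abs_sub_le N i j)
      linarith
    · have h1 := h.lyapunov_le_mul_fullSqError s₀ (κ := 2 * κ) (by linarith) hκ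
      rw [← hE] at h1
      have hσ := h.σt_pos
      set u := Real.exp (-ℓ) with hu
      have hu0 : 0 < u := Real.exp_pos _
      have hu1 : u ≤ 0.37 := exp_neg_logP_le _
      have hpow : (1 - 1 / 2 * x) ^ t ≤ u ^ 3 := by
        calc (1 - 1 / 2 * x) ^ t ≤ Real.exp (-(1 / 2 * x)) ^ t :=
              pow_le_pow_left₀ (by linarith) (Real.one_sub_le_exp_neg _) t
          _ = Real.exp (-(1 / 2 * x * t)) := by rw [← Real.exp_nat_mul]; ring_nf
          _ ≤ Real.exp (3 * -ℓ) := by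
              refine Real.exp_le_exp.2 ?_
              have h2 : 6 / x * ℓ ≤ t := (Nat.le_ceil _).trans (by exact_mod_cast ht)
              have h3 := mul_le_mul_of_nonneg_left h2 hx.le
              have h4 : x * (6 / x * ℓ) = 6 * ℓ := by field_simp
              linarith
          _ = u ^ 3 := by rw [hu, ← Real.exp_nat_mul]; norm_num
      have hEu : κ ^ 2 * E * u ≤ ε := by
        have h2 := mul_exp_neg_logP_le (x := κ ^ 2 * E / ε) (by positivity)
        rw [div_mul_eq_mul_div, div_le_one hε] at h2
        exact h2
      have hu2 : u ^ 2 ≤ 0.37 ^ 2 := pow_le_pow_left₀ hu0.le hu1 2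
      -- Of the three factors $u$, one brings $\kappa^2E$ below $\varepsilon$ and two absorb the
      -- constant 5.
      calc 2 / P.σt * ((1 - 1 / 2 * x) ^ t * lyapunov f P θstar α μ s₀)
          ≤ 2 / P.σt * (u ^ 3 * (5 / 4 * P.σt * (2 * κ) * E)) := by
            have := h.lyapunov_nonneg s₀
            gcongr
        _ = 5 * u ^ 2 * (κ * E * u) := by field_simp; ring
        _ ≤ 1 * (κ ^ 2 * E * u) := by
            gcongr
            · linarith
            · nlinarith
        _ ≤ ε := by rwa [one_mul]
  · refine (expect_law_jumps_le z₀ pos₀ _ k).trans (ENNReal.ofReal_le_ofReal ?_)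
    calc (⌈6 / x * ℓ⌉₊ : ℝ) * (P.pcomm * (N / K))
        = ((⌈6 / x * ℓ⌉₊ : ℝ) * (P.pcomm * N)) / K := by ring
      _ ≤ (c * (n * κ / γ) * J * ℓ) / K := by gcongr
      _ = _ := by field_simp
  · exact (expect_law_sum_jumps_le z₀ pos₀ _).trans (ENNReal.ofReal_le_ofReal hjumps)

end Convergence

/-! ### Parameters of Token Gradient Descent -/

theorem sigmaT_pos (n K : ℕ) [NeZero n] {σ : ℝ} (hσ : 0 < σ) : 0 < sigmaT n K σ := by
  have hn : (0 : ℝ) < n := by exact_mod_cast Nat.pos_of_ne_zero (NeZero.ne n)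
  unfold sigmaT
  positivity

theorem sigmaT_le (n K : ℕ) {σ : ℝ} (hσ : 0 < σ) : sigmaT n K σ ≤ σ := by
  unfold sigmaT
  refine mul_le_of_le_one_left hσ.le (div_le_one_of_le₀ ?_ (by positivity))
  linarith [(Nat.cast_nonneg K : (0 : ℝ) ≤ K)]

/-- $K\le n$ means $n+K\le2n$. This converts $L/\tilde\sigma$ into $L/\sigma$ at the cost of a
factor 2. -/
theorem le_two_mul_sigmaT {n K : ℕ} [NeZero n] (hK : K ≤ n) {σ : ℝ} (hσ : 0 < σ) :
    σ ≤ 2 * sigmaT n K σ := by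
  have hn : (0 : ℝ) < n := by exact_mod_cast Nat.pos_of_ne_zero (NeZero.ne n)
  have hKn : (K : ℝ) ≤ n := by exact_mod_cast hK
  have h1 := add_mul_sigmaT n K σ
  have h2 := sigmaT_pos n K hσ
  have h3 : n * σ ≤ n * (2 * sigmaT n K σ) := by nlinarith
  exact le_of_mul_le_mul_left h3 hn

theorem smul_sigmaT_add_sum_gradient {n m d : ℕ} [NeZero n] (K : ℕ)
    {f : Fin n → Fin m → Vec d → ℝ} {σ : ℝ} (hf : ∀ i j, Differentiable ℝ (f i j))
    {θstar : Vec d} (h : IsMinOn (objective f σ) Set.univ θstar) :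
    ((n : ℝ) + K) • sigmaT n K σ • θstar + ∑ i, ∑ j, ∇ (f i j) θstar = 0 := by
  rw [smul_smul, add_mul_sigmaT]
  exact sum_gradient_eq_zero hf h

section TGD
variable {n K : ℕ} [NeZero n] [NeZero K] {σ L α : ℝ}

theorem muTGD_pos (hσ : 0 < σ) (hL : 0 ≤ L) : 0 < muTGD n K σ L := by
  have hK : (0 : ℝ) < K := by exact_mod_cast Nat.pos_of_ne_zero (NeZero.ne K)
  have := sigmaT_pos n K hσ
  unfold muTGD
  positivity

/-- For $\alpha=2K/L$ the upper bound needs $\tilde\sigma\le\sigma\le L$, so that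
$\tilde\sigma+L\le2L$. -/
theorem alpha_mem_Icc_muTGD (hσ : 0 < σ) (hL : 0 ≤ L)
    (hα : σ ≤ L ∧ α = 2 * K / L ∨ α = 2 * K / (sigmaT n K σ + L)) :
    2 * muTGD n K σ L ≤ α ∧ α ≤ 4 * muTGD n K σ L := by
  have hK : (0 : ℝ) < K := by exact_mod_cast Nat.pos_of_ne_zero (NeZero.ne K)
  have hs := sigmaT_pos n K hσ
  have hs' := sigmaT_le n K hσ
  have hμ := muTGD_pos (n := n) (K := K) hσ hL
  have h2 : 2 * muTGD n K σ L = 2 * K / (sigmaT n K σ + L) := by unfold muTGD; ring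
  rcases hα with ⟨hσL, rfl⟩ | rfl
  · have hL0 : 0 < L := hσ.trans_le hσL
    refine ⟨?_, ?_⟩
    · rw [h2]
      gcongr
      linarith
    · have h4 : 4 * muTGD n K σ L = 4 * K / (sigmaT n K σ + L) := by unfold muTGD; ring
      rw [h4, div_le_div_iff₀ hL0 (by linarith)]
      nlinarith
  · rw [← h2]
    exact ⟨le_rfl, by linarith⟩

theorem etaTGD_mul_muTGD_le (hσ : 0 < σ) (hL : 0 ≤ L) :
    2 * n * (etaTGD n K σ L α * muTGD n K σ L) ≤ 1 := by
  have hn : (0 : ℝ) < n := by exact_mod_cast Nat.pos_of_ne_zero (NeZero.ne n)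
  have hK : (0 : ℝ) < K := by exact_mod_cast Nat.pos_of_ne_zero (NeZero.ne K)
  have hs := sigmaT_pos n K hσ
  have hμ := muTGD_pos (n := n) (K := K) hσ hL
  calc 2 * n * (etaTGD n K σ L α * muTGD n K σ L)
      ≤ 2 * n * (sigmaT n K σ * (1 / 2) / (2 * n * K) * (K / sigmaT n K σ)) := by
        gcongr
        · exact min_le_left _ _
        · unfold muTGD
          gcongr
          linarith
    _ ≤ 1 := by
        field_simp
        norm_num

/-- Both entries of the minimum defining $\eta$ are at least $1/(16n\kappa\mu)$. The $\frac12$ on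
the left is $p_{\rm comm}$. -/
theorem le_etaTGD_mul_muTGD (hKn : K ≤ n) (hσ : 0 < σ) (hL : 0 ≤ L) (hα0 : 0 < α)
    (hα : α ≤ 4 * muTGD n K σ L) :
    1 / 2 ≤ 8 * (n * (1 + L / σ)) * (etaTGD n K σ L α * muTGD n K σ L) := by
  have hn : (0 : ℝ) < n := by exact_mod_cast Nat.pos_of_ne_zero (NeZero.ne n)
  have hK : (0 : ℝ) < K := by exact_mod_cast Nat.pos_of_ne_zero (NeZero.ne K)
  have hs := sigmaT_pos n K hσ
  have hμ := muTGD_pos (n := n) (K := K) hσ hL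
  have hκ : 0 < 1 + L / σ := by positivity
  have h1 : 1 + L / sigmaT n K σ ≤ 2 * (1 + L / σ) := by
    have h2 : L / sigmaT n K σ ≤ L / (σ / 2) := by
      gcongr
      linarith [le_two_mul_sigmaT hKn hσ]
    have h3 : L / (σ / 2) = 2 * (L / σ) := by field_simp
    linarith
  have h2 : 1 / (16 * (n * (1 + L / σ)) * muTGD n K σ L) ≤ etaTGD n K σ L α := by
    refine le_min ?_ ?_
    · have h3 : muTGD n K σ L = K / (sigmaT n K σ * (1 + L / sigmaT n K σ)) := by
        unfold muTGD
        congr 1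
        field_simp
      calc 1 / (16 * (n * (1 + L / σ)) * muTGD n K σ L)
          = sigmaT n K σ * (1 + L / sigmaT n K σ) / (16 * (n * (1 + L / σ)) * K) := by
            rw [h3]
            field_simp
        _ ≤ sigmaT n K σ * (2 * (1 + L / σ)) / (16 * (n * (1 + L / σ)) * K) := by gcongr
        _ = sigmaT n K σ / (8 * n * K) := by
            field_simp
            norm_num
        _ ≤ _ := by
            rw [div_le_div_iff₀ (by positivity) (by positivity)]
            have : 0 < sigmaT n K σ * (n * K) := by positivity
            linarith
    · calc 1 / (16 * (n * (1 + L / σ)) * muTGD n K σ L)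
          = 1 / 2 / (n * (4 * muTGD n K σ L) * (2 * (1 + L / σ))) := by
            field_simp
            norm_num
        _ ≤ _ := by gcongr
  calc (1 : ℝ) / 2 = 8 * (n * (1 + L / σ))
        * (1 / (16 * (n * (1 + L / σ)) * muTGD n K σ L) * muTGD n K σ L) := by
          field_simp
          norm_num
    _ ≤ _ := by gcongr

theorem admissible_paramsTGD {d : ℕ} {f : Fin n → Vec d → ℝ} (hKn : K ≤ n) (hσ : 0 < σ)
    (hL : 0 ≤ L) (hf : ∀ i, ConvexSmooth (f i) L)
    (hα : σ ≤ L ∧ α = 2 * K / L ∨ α = 2 * K / (sigmaT n K σ + L)) {θstar : Vec d}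
    (hθ : IsMinOn (objective (fun i (_ : Fin 1) => f i) σ) Set.univ θstar) :
    Admissible K (fun i (_ : Fin 1) => f i) (fun _ _ => L) (paramsTGD n K σ L α) θstar α
      (muTGD n K σ L) (etaTGD n K σ L α) := by
  have hn : (0 : ℝ) < n := by exact_mod_cast Nat.pos_of_ne_zero (NeZero.ne n)
  have hK : (0 : ℝ) < K := by exact_mod_cast Nat.pos_of_ne_zero (NeZero.ne K)
  have hs := sigmaT_pos n K hσ
  have hμ := muTGD_pos (n := n) (K := K) hσ hL
  obtain ⟨hα1, hα2⟩ := alpha_mem_Icc_muTGD hσ hL hα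
  have hα0 : 0 < α := by linarith
  have hη : 0 < etaTGD n K σ L α := lt_min (by positivity) (by positivity)
  exact {
    smooth := fun i _ => hf i
    L_nonneg := fun _ _ => hL
    K_le := hKn
    optimal := smul_sigmaT_add_sum_gradient K (fun i _ => (hf i).differentiable) hθ
    σt_pos := hs
    μ_pos := hμ
    η_pos := hη
    two_mul_μ_le := hα1
    α_le := hα2
    μ_mul_le := fun _ => by
      simp only [paramsTGD, muTGD, Finset.univ_unique, Finset.sum_const, Finset.card_singleton,
        one_smul]
      rw [div_mul_cancel₀ _ (by positivity)]
    ρcomm_pos := by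
      simp only [paramsTGD]
      positivity
    ρcomm_le := by
      have h1 : etaTGD n K σ L α ≤ sigmaT n K σ * (1 / 2) / (2 * n * K) := min_le_left _ _
      rw [le_div_iff₀ (by positivity)] at h1
      simp only [paramsTGD]
      rw [div_le_iff₀ (by positivity)]
      linarith
    ρcomm_eq := by
      simp only [paramsTGD]
      field_simp
    ρcomp_pos := fun _ _ => by
      simp only [paramsTGD]
      positivity
    ρcomp_le := fun _ _ => by
      have h1 : etaTGD n K σ L α ≤ 1 / 2 / (n * α * (1 + L / sigmaT n K σ)) := min_le_right _ _
      rw [le_div_iff₀ (by positivity)] at h1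
      simp only [paramsTGD]
      linarith
    ρcomp_eq := fun _ _ => by
      simp only [paramsTGD]
      ring }

end TGD

/-! ### Parameters of Token Variance Reduction -/

section TVR
variable {n m K : ℕ} [NeZero n] {σ : ℝ} {L : Fin n → Fin m → ℝ}

theorem one_add_sum_le_kappaS (i : Fin n) :
    1 + ∑ j, L i j / sigmaT n K σ ≤ kappaS K σ L :=
  Finset.le_sup' (fun i => 1 + ∑ j, L i j / sigmaT n K σ) (Finset.mem_univ i)

theorem div_sigmaT_le_kappaS (hσ : 0 < σ) (hL : ∀ i j, 0 ≤ L i j) (i : Fin n) (j : Fin m) :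
    L i j / sigmaT n K σ ≤ kappaS K σ L := by
  have h1 := one_add_sum_le_kappaS (K := K) (σ := σ) (L := L) i
  have h2 := Finset.single_le_sum
    (fun j _ => div_nonneg (hL i j) (sigmaT_nonneg n K hσ)) (Finset.mem_univ j)
  linarith

theorem muTVR_pos [NeZero K] (hσ : 0 < σ) (hL : ∀ i j, 0 ≤ L i j) : 0 < muTVR K σ L := by
  have hK : (0 : ℝ) < K := by exact_mod_cast Nat.pos_of_ne_zero (NeZero.ne K)
  have hs := sigmaT_pos n K hσ
  have hκ := one_le_kappaS K hσ hL
  unfold muTVR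
  positivity

theorem alphaTVR_eq : alphaTVR K σ L = 2 * muTVR K σ L := by
  unfold alphaTVR muTVR
  ring

variable [NeZero m]

theorem one_le_numData_add_kappaS (hσ : 0 < σ) (hL : ∀ i j, 0 ≤ L i j) :
    1 ≤ (m : ℝ) - 1 + kappaS K σ L := by
  have hm : (1 : ℝ) ≤ m := by exact_mod_cast Nat.one_le_iff_ne_zero.2 (NeZero.ne m)
  linarith [one_le_kappaS K hσ hL]

theorem pcompTVR_eq (hσ : 0 < σ) (hL : ∀ i j, 0 ≤ L i j) :
    pcompTVR K σ L = ((m : ℝ) - 1 + kappaS K σ L)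
      / ((m : ℝ) - 1 + kappaS K σ L + kappaS K σ L) := by
  have hM := one_le_numData_add_kappaS (K := K) hσ hL
  have hκ := one_le_kappaS K hσ hL
  set M := (m : ℝ) - 1 + kappaS K σ L with hMdef
  have hM0 : 0 < M := by linarith
  rw [pcompTVR, ← hMdef]
  field_simp

theorem one_sub_pcompTVR_eq (hσ : 0 < σ) (hL : ∀ i j, 0 ≤ L i j) :
    1 - pcompTVR K σ L = kappaS K σ L / ((m : ℝ) - 1 + kappaS K σ L + kappaS K σ L) := by
  have hM := one_le_numData_add_kappaS (K := K) hσ hL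
  have hκ := one_le_kappaS K hσ hL
  rw [pcompTVR_eq hσ hL, one_sub_div (by linarith)]
  ring

variable [NeZero K]

/-- The choice of $p_{\rm comp}$ makes the two entries of the minimum defining $\eta$ equal. -/
theorem etaTVR_mul_muTVR (hσ : 0 < σ) (hL : ∀ i j, 0 ≤ L i j) :
    etaTVR K σ L * muTVR K σ L
      = 1 / (2 * n * ((m : ℝ) - 1 + kappaS K σ L + kappaS K σ L)) := by
  have hn : (0 : ℝ) < n := by exact_mod_cast Nat.pos_of_ne_zero (NeZero.ne n)
  have hK : (0 : ℝ) < K := by exact_mod_cast Nat.pos_of_ne_zero (NeZero.ne K)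
  have hs := sigmaT_pos n K hσ
  have hκ : 0 < kappaS K σ L := by linarith [one_le_kappaS K hσ hL]
  have hM : 0 < (m : ℝ) - 1 + kappaS K σ L := by
    linarith [one_le_numData_add_kappaS (K := K) hσ hL]
  have h1 : sigmaT n K σ * (1 - pcompTVR K σ L) / (2 * n * K)
      = pcompTVR K σ L / (alphaTVR K σ L * n * ((m : ℝ) - 1 + kappaS K σ L)) := by
    rw [one_sub_pcompTVR_eq hσ hL, pcompTVR_eq hσ hL, alphaTVR]
    field_simp
  rw [etaTVR, ← h1, min_self, one_sub_pcompTVR_eq hσ hL, muTVR]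
  field_simp

theorem admissible_paramsTVR {d : ℕ} {f : Fin n → Fin m → Vec d → ℝ} (hKn : K ≤ n)
    (hσ : 0 < σ) (hL : ∀ i j, 0 ≤ L i j) (hf : ∀ i j, ConvexSmooth (f i j) (L i j))
    {θstar : Vec d} (hθ : IsMinOn (objective f σ) Set.univ θstar) :
    Admissible K f L (paramsTVR K σ hσ L hL) θstar (alphaTVR K σ L) (muTVR K σ L)
      (etaTVR K σ L) := by
  have hn : (0 : ℝ) < n := by exact_mod_cast Nat.pos_of_ne_zero (NeZero.ne n)
  have hm : (0 : ℝ) < m := by exact_mod_cast Nat.pos_of_ne_zero (NeZero.ne m)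
  have hK : (0 : ℝ) < K := by exact_mod_cast Nat.pos_of_ne_zero (NeZero.ne K)
  have hs := sigmaT_pos n K hσ
  have hκ : 0 < kappaS K σ L := by linarith [one_le_kappaS K hσ hL]
  have hM : 0 < (m : ℝ) - 1 + kappaS K σ L := by
    linarith [one_le_numData_add_kappaS (K := K) hσ hL]
  have hμ := muTVR_pos (n := n) (K := K) hσ hL
  have hα : 0 < alphaTVR K σ L := by rw [alphaTVR_eq]; positivity
  have hp : 0 < pcompTVR K σ L := by rw [pcompTVR_eq hσ hL]; positivity
  have hp' : 0 < 1 - pcompTVR K σ L := by rw [one_sub_pcompTVR_eq hσ hL]; positivity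
  have hη : 0 < etaTVR K σ L := lt_min (by positivity) (by positivity)
  have hL' : ∀ i j, 0 < 1 + L i j / sigmaT n K σ := fun i j => by
    have := div_nonneg (hL i j) hs.le
    linarith
  have hS : ∀ i, 0 < ∑ j, (1 + L i j / sigmaT n K σ) := fun i =>
    Finset.sum_pos (fun j _ => hL' i j) Finset.univ_nonempty
  -- The $-1$ appears because $\kappa_s$ already contains one of the $m$ summands 1.
  have hSM : ∀ i, ∑ j, (1 + L i j / sigmaT n K σ) ≤ (m : ℝ) - 1 + kappaS K σ L := fun i => by
    have h1 := one_add_sum_le_kappaS (K := K) (σ := σ) (L := L) i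
    rw [Finset.sum_add_distrib, Finset.sum_const, Finset.card_univ, Fintype.card_fin,
      nsmul_eq_mul, mul_one]
    linarith
  have hq : ∀ i j, 0 < samplingTVR K σ L i j := fun i j => div_pos (hL' i j) (hS i)
  exact {
    smooth := hf
    L_nonneg := hL
    K_le := hKn
    optimal := smul_sigmaT_add_sum_gradient K (fun i j => (hf i j).differentiable) hθ
    σt_pos := hs
    μ_pos := hμ
    η_pos := hη
    two_mul_μ_le := alphaTVR_eq.ge
    α_le := by rw [alphaTVR_eq]; linarith
    μ_mul_le := fun i => by
      have h1 := one_add_sum_le_kappaS (K := K) (σ := σ) (L := L) i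
      have h2 : sigmaT n K σ + ∑ j, L i j
          = sigmaT n K σ * (1 + ∑ j, L i j / sigmaT n K σ) := by
        rw [← Finset.sum_div]
        field_simp
      simp only [paramsTVR, muTVR]
      rw [h2, div_mul_eq_mul_div, div_le_iff₀ (by positivity)]
      gcongr
    ρcomm_pos := by
      simp only [paramsTVR]
      positivity
    ρcomm_le := by
      have h1 : etaTVR K σ L ≤ sigmaT n K σ * (1 - pcompTVR K σ L) / (2 * n * K) :=
        min_le_left _ _
      rw [le_div_iff₀ (by positivity)] at h1
      simp only [paramsTVR]
      rw [div_le_iff₀ (by positivity)]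
      linarith
    ρcomm_eq := by
      simp only [paramsTVR]
      field_simp
    ρcomp_pos := fun i j => by
      have := hq i j
      simp only [paramsTVR]
      positivity
    ρcomp_le := fun i j => by
      have h1 : etaTVR K σ L ≤ pcompTVR K σ L
          / (alphaTVR K σ L * n * ((m : ℝ) - 1 + kappaS K σ L)) := min_le_right _ _
      rw [le_div_iff₀ (by positivity)] at h1
      have h2 := hL' i j
      have h3 := hS i
      simp only [paramsTVR]
      -- Sampling proportionally to $1+L_{ij}/\tilde\sigma$ cancels this factor and leaves only the
      -- normalizing sum.
      calc alphaTVR K σ L * etaTVR K σ L / (pcompTVR K σ L / n * samplingTVR K σ L i j)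
            * (1 + L i j / sigmaT n K σ)
          = etaTVR K σ L * (alphaTVR K σ L * n * ∑ j, (1 + L i j / sigmaT n K σ))
            / pcompTVR K σ L := by
            rw [samplingTVR]
            generalize ∑ j, (1 + L i j / sigmaT n K σ) = S at *
            generalize 1 + L i j / sigmaT n K σ = l at *
            field_simp
        _ ≤ etaTVR K σ L * (alphaTVR K σ L * n * ((m : ℝ) - 1 + kappaS K σ L))
            / pcompTVR K σ L := by
            gcongr
            exact hSM i
        _ ≤ 1 := (div_le_one hp).2 h1
    ρcomp_eq := fun i j => by
      have := hq i j
      simp only [paramsTVR]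
      rw [sub_sub_cancel]
      field_simp }

end TVR

end TokenAlg

end

/-! ### The complexity bounds for the two algorithms -/

theorem mainTheorem5 :
    ∃ a : ℝ, 0 < a ∧ ∀ A : ℝ, a ≤ A → ∃ c : ℝ, 0 < c ∧
      -- Token Gradient Descent
      (∀ (n K d : ℕ) [NeZero n] [NeZero K], K ≤ n →
        ∀ (f : Fin n → TokenAlg.Vec d → ℝ) (σ L α : ℝ), 0 < σ → 0 ≤ L →
        (∀ i, TokenAlg.ConvexSmooth (f i) L) →
        (σ ≤ L ∧ α = 2 * K / L ∨ α = 2 * K / (TokenAlg.sigmaT n K σ + L)) →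
        ∀ θstar : TokenAlg.Vec d,
        IsMinOn (TokenAlg.objective (fun i (_ : Fin 1) => f i) σ) Set.univ θstar →
        ∀ (W : Matrix (Fin n) (Fin n) ℝ) (hW : W ∈ Matrix.colStochastic ℝ (Fin n)) (C γ : ℝ),
        0 < C → 0 < γ → TokenAlg.MixesTo W (fun _ => 1 / (n : ℝ)) C γ →
        ∀ N : ℕ,
        a * γ⁻¹ * TokenAlg.logP
          (C / (TokenAlg.etaTGD n K σ L α * TokenAlg.muTGD n K σ L)) ≤ N →
        N ≤ A * γ⁻¹ * TokenAlg.logP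
          (C / (TokenAlg.etaTGD n K σ L α * TokenAlg.muTGD n K σ L)) →
        ∀ (z₀ : Fin n → TokenAlg.Vec d) (pos₀ : Fin K → Fin n) (ε : ℝ), 0 < ε →
        let P := TokenAlg.paramsTGD n K σ L α
        let s₀ : TokenAlg.State n 1 K d :=
          TokenAlg.initState (fun i _ => f i) P (fun i _ => z₀ i) pos₀
        let law := TokenAlg.law (fun i _ => f i) P W hW N s₀
        let κ : ℝ := 1 + L / σ
        let logJ := TokenAlg.logP
          (C / (TokenAlg.etaTGD n K σ L α * TokenAlg.muTGD n K σ L))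
        let logε := TokenAlg.logP (κ ^ 2 * TokenAlg.fullSqError θstar s₀ / ε)
        ∃ T : ℕ,
          (∀ t : ℕ, T ≤ t →
            TokenAlg.expect (law t) (fun s => ENNReal.ofReal (TokenAlg.sqError θstar s))
              ≤ ENNReal.ofReal ε) ∧
          (∀ k : Fin K, TokenAlg.expect (law T) (fun s => (s.jumps k : ENNReal))
              ≤ ENNReal.ofReal (c * (n * κ / (K * γ)) * logJ * logε)) ∧
          TokenAlg.expect (law T) (fun s => ((∑ k, s.jumps k : ℕ) : ENNReal))
              ≤ ENNReal.ofReal (c * (n * κ / γ) * logJ * logε)) ∧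
      -- Token Variance Reduction
      (∀ (n m K d : ℕ) [NeZero n] [NeZero m] [NeZero K], K ≤ n →
        ∀ (f : Fin n → Fin m → TokenAlg.Vec d → ℝ) (σ : ℝ) (L : Fin n → Fin m → ℝ)
          (hσ : 0 < σ) (hL : ∀ i j, 0 ≤ L i j),
        (∀ i j, TokenAlg.ConvexSmooth (f i j) (L i j)) →
        ∀ θstar : TokenAlg.Vec d,
        IsMinOn (TokenAlg.objective f σ) Set.univ θstar →
        ∀ (W : Matrix (Fin n) (Fin n) ℝ) (hW : W ∈ Matrix.colStochastic ℝ (Fin n)) (C γ : ℝ),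
        0 < C → 0 < γ → TokenAlg.MixesTo W (fun _ => 1 / (n : ℝ)) C γ →
        ∀ N : ℕ,
        a * γ⁻¹ * TokenAlg.logP (C / (TokenAlg.etaTVR K σ L * TokenAlg.muTVR K σ L)) ≤ N →
        N ≤ A * γ⁻¹ * TokenAlg.logP (C / (TokenAlg.etaTVR K σ L * TokenAlg.muTVR K σ L)) →
        ∀ (z₀ : Fin n → Fin m → TokenAlg.Vec d) (pos₀ : Fin K → Fin n) (ε : ℝ), 0 < ε →
        let P := TokenAlg.paramsTVR K σ hσ L hL
        let s₀ : TokenAlg.State n m K d := TokenAlg.initState f P z₀ pos₀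
        let law := TokenAlg.law f P W hW N s₀
        let κs := TokenAlg.kappaS K σ L
        let logJ := TokenAlg.logP (C / (TokenAlg.etaTVR K σ L * TokenAlg.muTVR K σ L))
        let logε := TokenAlg.logP (κs ^ 2 * TokenAlg.fullSqError θstar s₀ / ε)
        ∃ T : ℕ,
          (∀ t : ℕ, T ≤ t →
            TokenAlg.expect (law t) (fun s => ENNReal.ofReal (TokenAlg.sqError θstar s))
              ≤ ENNReal.ofReal ε) ∧
          (∀ k : Fin K, TokenAlg.expect (law T) (fun s => (s.jumps k : ENNReal))
              ≤ ENNReal.ofReal (c * (n * κs / (K * γ)) * logJ * logε)) ∧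
          TokenAlg.expect (law T) (fun s => ((∑ k, s.jumps k : ℕ) : ENNReal))
              ≤ ENNReal.ofReal (c * (n * κs / γ) * logJ * logε) ∧
          (∀ i : Fin n, TokenAlg.expect (law T) (fun s => (s.grads i : ENNReal))
              ≤ ENNReal.ofReal (c * (m + κs) * logε))) := by
  -- 6 is the exponent in `MixesTo.error_le`. With $T\eta\mu\le7\log_+(\cdot)$, the jumps need
  -- $7\cdot8A=56A$ and the gradient steps $7\cdot2=14$.
  refine ⟨6, by norm_num, fun A hA => ⟨56 * A + 14, by linarith, ?_, ?_⟩⟩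
  · intro n K d _ _ hKn f σ L α hσ hL hf hα θstar hθ W hW C γ hC hγ hmix N hN hNA z₀ pos₀ ε hε
    have h := TokenAlg.admissible_paramsTGD hKn hσ hL hf hα hθ
    have hκ : ∀ (i : Fin n) (j : Fin 1),
        L / (TokenAlg.paramsTGD n K σ L α).σt ≤ 2 * (1 + L / σ) := fun _ _ => by
      have h1 : L / TokenAlg.sigmaT n K σ ≤ L / (σ / 2) := by
        gcongr
        linarith [TokenAlg.le_two_mul_sigmaT hKn hσ]
      have h2 : L / (σ / 2) = 2 * (L / σ) := by field_simp
      exact h1.trans (by linarith)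
    obtain ⟨T, -, h1, h2, h3⟩ := h.complexity hW hC hγ hmix hN hNA (by linarith)
      (TokenAlg.etaTGD_mul_muTGD_le hσ hL) (κ := 1 + L / σ)
      (by linarith [div_nonneg hL hσ.le]) hκ
      (TokenAlg.le_etaTGD_mul_muTGD hKn hσ hL h.α_pos h.α_le)
      (fun i _ => z₀ i) pos₀ hε (c := 56 * A + 14) (by linarith)
    exact ⟨T, h1, h2, h3⟩
  · intro n m K d _ _ _ hKn f σ L hσ hL hf θstar hθ W hW C γ hC hγ hmix N hN hNA z₀ pos₀ ε hε
    have h := TokenAlg.admissible_paramsTVR hKn hσ hL hf hθ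
    have hn : (0 : ℝ) < n := by exact_mod_cast Nat.pos_of_ne_zero (NeZero.ne n)
    have hκ := TokenAlg.one_le_kappaS K hσ hL
    have hM := TokenAlg.one_le_numData_add_kappaS (K := K) hσ hL
    have hημ := TokenAlg.etaTVR_mul_muTVR (K := K) hσ hL
    obtain ⟨T, hT, h1, h2, h3⟩ := h.complexity hW hC hγ hmix hN hNA (by linarith)
      (by
        rw [hημ, mul_one_div, div_le_one (by positivity)]
        exact le_mul_of_one_le_right (by positivity) (by linarith)) hκ
      (fun i j => (TokenAlg.div_sigmaT_le_kappaS hσ hL i j).trans (by linarith))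
      (by
        change 1 - TokenAlg.pcompTVR K σ L ≤ _
        rw [hημ, TokenAlg.one_sub_pcompTVR_eq hσ hL, mul_one_div,
          div_le_div_iff₀ (by positivity) (by positivity)]
        have : 0 < n * TokenAlg.kappaS K σ L
            * ((m : ℝ) - 1 + TokenAlg.kappaS K σ L + TokenAlg.kappaS K σ L) := by positivity
        linarith)
      z₀ pos₀ hε (c := 56 * A + 14) (by linarith)
    refine ⟨T, h1, h2, h3, fun i => (TokenAlg.expect_law_grads_le z₀ pos₀ T i).trans
      (ENNReal.ofReal_le_ofReal ?_)⟩
    have h4 : (1 - (1 - TokenAlg.pcompTVR K σ L)) / n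
        = 2 * ((m : ℝ) - 1 + TokenAlg.kappaS K σ L)
          * (TokenAlg.etaTVR K σ L * TokenAlg.muTVR K σ L) := by
      rw [hημ, TokenAlg.pcompTVR_eq hσ hL]
      field_simp
      ring
    set κs := TokenAlg.kappaS K σ L
    set ℓ := TokenAlg.logP (κs ^ 2 * TokenAlg.fullSqError θstar
      (TokenAlg.initState f (TokenAlg.paramsTVR K σ hσ L hL) z₀ pos₀) / ε)
    have hℓ : 1 ≤ ℓ := TokenAlg.one_le_logP _
    change T * ((1 - (1 - TokenAlg.pcompTVR K σ L)) / n) ≤ (56 * A + 14) * (m + κs) * ℓ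
    calc _ = 2 * ((m : ℝ) - 1 + κs)
          * (T * (TokenAlg.etaTVR K σ L * TokenAlg.muTVR K σ L)) := by rw [h4]; ring
      _ ≤ 2 * ((m : ℝ) - 1 + κs) * (7 * ℓ) := by gcongr
      _ = 14 * ((m : ℝ) - 1 + κs) * ℓ := by ring
      _ ≤ _ := by
        gcongr <;> linarith
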